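/- Let $\phi\colon\mathbb P^1\to\mathbb P^1$ be a rational map of degree $d\ge 2$, and let $h\in\mathrm{PGL}_2$ be an automorphism of $\phi$ (that is, $\phi h=h\phi$) of prime order $p$. Let $K$ be a field over which $\phi$, $h$ and all the points of $\mathrm{Fix}(h)=\{P_i=[x_i:y_i]\}$ are defined, let $q\geq 0$ be the characteristic of $K$, and regard $\mathbb P^1$ as $\mathbb P^1(\overline K)$. If $A=[A_1:A_2]$ and $B=[B_1:B_2]$ are pairs of forms in $x,y$, write $A-B$ for the form $A_1B_2-A_2B_1$, whose zeros are the points where the two maps agree. For $N\ge 1$ set $$\Psi_{pN}=\prod_{j=1}^{p-1}\bigl(\phi^N-h^j\bigr),\qquad \Psi^*_{pN}=\prod_{k\mid N,\ pk\nmid N}\Psi_{pk}^{\mu(N/k)},\qquad \widetilde{\Psi^*_{pN}}=\frac{\Psi^*_{pN}}{\prod_{P_i\in\mathrm{Fix}(h)}(y_ix-x_iy)^{\delta_i}},$$ where $\phi^N$ is the $N$-th iterate, $\mu$ is the Möbius function and $\delta_i$ is the order of $\Psi^*_{pN}$ along $y_ix-x_iy$. These are well defined up to nonzero constant factors. For $Q=[a:b]\in\mathbb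 P^1(\overline K)$ let $\widetilde{b^*_Q}(pN)\in\mathbb Z$ be the order of the rational function $\widetilde{\Psi^*_{pN}}$ along $bx-ay$. The point $Q$ has $h$-period $M$ if $\phi^M(Q)=h^j(Q)$ for some $j>0$ with $p\nmid j$. Let $m$ be its primitive $h$-period, i.e. the least $M\ge 1$ that is an $h$-period of $Q$; set $m=\infty$ if there is none. If $Q\notin\mathrm{Fix}(h)$ and $m<\infty$, let $1\le j\le p-1$ be the unique integer with $\phi^m(Q)=h^j(Q)$, and let $r$ be the multiplicative order in $\overline K^*$ of the ratio $$\frac{\lambda_1(\phi^m,Q)}{\lambda_1(h^j,Q)},$$ where $\lambda_1(\psi,Q)$ is the coefficient of $z-Q$ in the expansion of $\psi(z)$ at $z=Q$, in any coordinate $z$ of $\mathbb P^1(\overline K)$ in which no point of the $h$-orbit of $Q$ is $\infty$ (for every such coordinate the claim below holds). Set $r=\infty$ if $m=\infty$ or if the ratio is not a root of unity. Then for all $N\ge 1$: 1. $\widetilde{\Psi^*_{pN}}\in K[x,y]$. 2. $\widetilde{b^*_Q}(pN)\ge 0$ for every $Q\in\mathbb P^1(\overline K)$. 3. If $Q\in\mathrm{Fix}(h)$,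 then $\widetilde{b^*_Q}(pN)=0$. If $Q\notin\mathrm{Fix}(h)$, then $\widetilde{b^*_Q}(pN)\ge 1$ if and only if one of the following holds: (i) $N=m$; (ii) $N=mr$ and $p\nmid r$; (iii) $N=mrq^s$ for some $s\ge 1$, where $p\nmid r$ and $q\ne p$. (An equality that involves $\infty$ is false; in characteristic $q=0$ case (iii) does not occur, as $N\geq 1$.) -/

import Mathlib

open scoped LinearAlgebra.Projectivization MatrixGroups

namespace HTuned

noncomputable section

/-- Binary polynomials `K[x, y]`, with `x = X 0` and `y = X 1`. -/
abbrev BinPoly (K : Type*) [Field K] : Type _ := MvPolynomial (Fin 2) K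

/-- Rational functions `K(x, y)`. -/
abbrev RatFun (K : Type*) [Field K] : Type _ := FractionRing (BinPoly K)

/-- The projective line over `K`; the class of `![a, b]` is the point `[a : b]`. -/
abbrev P1 (K : Type*) [Field K] : Type _ := ℙ K (Fin 2 → K)

/-- A pair `[A : B]` of binary polynomials, `A = Φ 0` and `B = Φ 1`. -/
abbrev Pair (K : Type*) [Field K] : Type _ := Fin 2 → BinPoly K

namespace Pair

variable {K : Type*} [Field K]

/-- Composition of pairs: `(Φ ∘ Θ)(x, y) = Φ(Θ(x, y))`. -/
def comp (Φ Θ : Pair K) : Pair K := fun i => MvPolynomial.bind₁ Θ (Φ i)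

/-- The iterates `Φ^n`; in particular `Φ^0 = [x : y]`. -/
def iter (Φ : Pair K) : ℕ → Pair K
  | 0 => MvPolynomial.X
  | n + 1 => comp Φ (iter Φ n)

/-- The pair `[ax + by : cx + dy]` of a matrix with rows `(a, b)` and `(c, d)`. -/
def ofGL (g : GL (Fin 2) K) : Pair K :=
  fun i => ∑ j, MvPolynomial.C (g i j) * MvPolynomial.X j

/-- The form `A D - B C` attached to `[A : B]` and `[C : D]`. Its zeros are the points where the two
maps agree, and it is zero exactly when `[A : B]` and `[C : D]` are the same rational map. -/
def cross (Φ Θ : Pair K) : BinPoly K := Φ 0 * Θ 1 - Φ 1 * Θ 0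

/-- Extension of scalars to the algebraic closure. -/
def toClosure (Φ : Pair K) : Pair (AlgebraicClosure K) :=
  fun i => MvPolynomial.map (algebraMap K (AlgebraicClosure K)) (Φ i)

/-- Conjugation by a change of coordinates: `f⁻¹ ∘ Φ ∘ f`. -/
def conj (f : GL (Fin 2) K) (Φ : Pair K) : Pair K :=
  comp (ofGL f⁻¹) (comp Φ (ofGL f))

/-- `A(T, 1)` for `A ∈ K[x, y]`. -/
def dehom (A : BinPoly K) : Polynomial K := MvPolynomial.aeval ![Polynomial.X, 1] A

/-- `λ_i(Φ, z)`: the coefficient of `T ^ i` in the expansion at `T = 0` of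
`A(z + T, 1) / B(z + T, 1)`, where `Φ = [A : B]` and `z ∈ K` is a point with `B(z, 1) ≠ 0`. -/
def lam (i : ℕ) (Φ : Pair K) (z : K) : K :=
  PowerSeries.coeff i
    ((Polynomial.taylor z (dehom (Φ 0)) : PowerSeries K) *
      (Polynomial.taylor z (dehom (Φ 1)) : PowerSeries K)⁻¹)

end Pair

/-- A form of degree `d` satisfies `A(a v) = a ^ d A(v)`. -/
theorem aeval_smul_of_isHomogeneous {K L : Type*} [Field K] [Field L] [Algebra K L] {A : BinPoly K}
    {d : ℕ} (hA : A.IsHomogeneous d) (a : L) (v : Fin 2 → L) :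
    MvPolynomial.aeval (a • v) A = a ^ d * MvPolynomial.aeval v A := by
  rw [MvPolynomial.aeval_def, MvPolynomial.aeval_def, MvPolynomial.eval₂_eq',
    MvPolynomial.eval₂_eq', Finset.mul_sum]
  refine Finset.sum_congr rfl fun m hm => ?_
  have h := hA (MvPolynomial.mem_support_iff.mp hm)
  rw [Finsupp.weight_apply, Finsupp.sum_fintype _ _ (by simp)] at h
  simp only [Pi.one_apply, smul_eq_mul, mul_one] at h
  simp only [Pi.smul_apply, smul_eq_mul, mul_pow, Finset.prod_mul_distrib,
    Finset.prod_pow_eq_pow_sum, h]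
  ring

/-- A morphism `ℙ¹ → ℙ¹` of degree `d` defined over `K`, given as `[F : G]` with binary forms `F`, `G`
of degree `d` over `K` that have no common zero on the projective line over the algebraic closure. -/
structure RatMap (K : Type*) [Field K] (d : ℕ) where
  toPair : Pair K
  homogeneous : ∀ i, (toPair i).IsHomogeneous d
  no_common_zero : ∀ v : Fin 2 → AlgebraicClosure K, v ≠ 0 →
    (fun i => MvPolynomial.aeval v (toPair i)) ≠ 0

namespace RatMap

variable {K : Type*} [Field K] {d : ℕ}

/-- The map induced by `φ` on the points of `ℙ¹` over the algebraic closure. -/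
def onPoints (φ : RatMap K d) (Q : P1 (AlgebraicClosure K)) : P1 (AlgebraicClosure K) :=
  Projectivization.mk (AlgebraicClosure K)
    (fun i => MvPolynomial.aeval Q.rep (φ.toPair i)) (φ.no_common_zero Q.rep Q.rep_nonzero)

/-- `onPoints` may be computed with arbitrary homogeneous coordinates. -/
theorem onPoints_mk (φ : RatMap K d) (v : Fin 2 → AlgebraicClosure K) (hv : v ≠ 0) :
    φ.onPoints (Projectivization.mk (AlgebraicClosure K) v hv) =
      Projectivization.mk (AlgebraicClosure K)
        (fun i => MvPolynomial.aeval v (φ.toPair i)) (φ.no_common_zero v hv) := by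
  obtain ⟨a, ha⟩ := Projectivization.exists_smul_eq_mk_rep (AlgebraicClosure K) v hv
  unfold onPoints
  rw [Projectivization.mk_eq_mk_iff']
  refine ⟨(a : AlgebraicClosure K) ^ d, ?_⟩
  funext i
  rw [← ha]
  exact (aeval_smul_of_isHomogeneous (φ.homogeneous i) (a : AlgebraicClosure K) v).symm

end RatMap

variable {K : Type*} [Field K] {d : ℕ}

/-- The map `h` on the points of `ℙ¹` over the algebraic closure, where `g` represents `h`. -/
def autOnPoints (g : GL (Fin 2) K) (Q : P1 (AlgebraicClosure K)) : P1 (AlgebraicClosure K) :=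
  g.map (algebraMap K (AlgebraicClosure K)) • Q

/-- The element `h` of `PGL₂(K)` represented by `g` is an automorphism of `φ`, that is,
`φ ∘ h = h ∘ φ` as rational maps. -/
def IsAut (φ : RatMap K d) (g : GL (Fin 2) K) : Prop :=
  Pair.cross (Pair.comp φ.toPair (Pair.ofGL g)) (Pair.comp (Pair.ofGL g) φ.toPair) = 0

/-- `Fix(h)`, as a set of points over the algebraic closure. -/
def fixSet (g : GL (Fin 2) K) : Set (P1 (AlgebraicClosure K)) := {Q | autOnPoints g Q = Q}

/-- The embedding of the `K`-rational points into the points over the algebraic closure. -/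
def ratPoint (P : P1 K) : P1 (AlgebraicClosure K) :=
  Projectivization.mk (AlgebraicClosure K)
    (fun i => algebraMap K (AlgebraicClosure K) (P.rep i)) (by
      intro h
      apply P.rep_nonzero
      funext i
      have := congrFun h i
      simpa using this)

/-- The linear form `b x - a y` attached to the point `[a : b]` (well defined up to a nonzero
constant factor). -/
def linForm (P : P1 K) : BinPoly K :=
  MvPolynomial.C (P.rep 1) * MvPolynomial.X 0 - MvPolynomial.C (P.rep 0) * MvPolynomial.X 1

/-- The order of vanishing of a nonzero rational function `f ∈ K(x, y)` at the point `Q = [a : b]` over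
the algebraic closure: the exponent of `b x - a y` in the factorization of `f`. -/
def ordAt (Q : P1 (AlgebraicClosure K)) (f : RatFun K) : ℤ :=
  (multiplicity (linForm Q) (MvPolynomial.map (algebraMap K (AlgebraicClosure K))
      (IsFractionRing.num (BinPoly K) f)) : ℤ) -
    (multiplicity (linForm Q) (MvPolynomial.map (algebraMap K (AlgebraicClosure K))
      (IsFractionRing.den (BinPoly K) f : BinPoly K)) : ℤ)

/-- `Ψ_{pN} = ∏_{j=1}^{p-1} (φ^N - h^j)`. -/
def Psi (φ : RatMap K d) (g : GL (Fin 2) K) (p N : ℕ) : BinPoly K :=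
  ∏ j ∈ Finset.Ico 1 p, Pair.cross (φ.toPair.iter N) (Pair.ofGL (g ^ j))

/-- `Ψ*_{pN} = ∏ Ψ_{pk} ^ μ(N / k)` over the `k ∣ N` with `p k ∤ N`. -/
def PsiStar (φ : RatMap K d) (g : GL (Fin 2) K) (p N : ℕ) : RatFun K :=
  ∏ k ∈ N.divisors with ¬ p * k ∣ N,
    (algebraMap (BinPoly K) (RatFun K) (Psi φ g p k)) ^ (ArithmeticFunction.moebius (N / k))

/-- The `h`-tuned dynatomic polynomial `Ψ̃*_{pN}`: `Ψ*_{pN}` divided by the product, over the points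
`P = [a : b]` of `Fix(h)` (supposed to be `K`-rational), of `(b x - a y) ^ δ`, with `δ` the order of
`Ψ*_{pN}` at `P`. -/
def PsiTilde (φ : RatMap K d) (g : GL (Fin 2) K) (p N : ℕ) : RatFun K :=
  PsiStar φ g p N /
    ∏ᶠ P ∈ {P : P1 K | ratPoint P ∈ fixSet g},
      (algebraMap (BinPoly K) (RatFun K) (linForm P)) ^ ordAt (ratPoint P) (PsiStar φ g p N)

/-- `Q` has `h`-period `N` for `φ`: `φ^N(Q) = h^j(Q)` for some `j > 0` with `p ∤ j`. -/
def HasHPeriod (φ : RatMap K d) (g : GL (Fin 2) K) (p : ℕ) (Q : P1 (AlgebraicClosure K))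
    (N : ℕ) : Prop :=
  ∃ j : ℕ, 0 < j ∧ ¬ p ∣ j ∧ φ.onPoints^[N] Q = (autOnPoints g)^[j] Q

/-- `Q` has primitive `h`-period `m` for `φ`. -/
def IsPrimitiveHPeriod (φ : RatMap K d) (g : GL (Fin 2) K) (p : ℕ)
    (Q : P1 (AlgebraicClosure K)) (m : ℕ) : Prop :=
  IsLeast {N : ℕ | 0 < N ∧ HasHPeriod φ g p Q N} m

/-- The point `[z : 1]`. -/
def affinePoint (z : K) : P1 K :=
  Projectivization.mk K ![z, 1] (fun h => one_ne_zero (congrFun h 1))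

/-- The point at infinity `[1 : 0]`. -/
def infinity : P1 K :=
  Projectivization.mk K ![1, 0] (fun h => one_ne_zero (congrFun h 0))

/-- The coordinate change `f` puts `Q` at the finite point `z`, and `∞` is not in the orbit of this
point under the conjugate of `h` by `f`: `f(z) = Q`, and `h^i(Q) ≠ f(∞)` for all `i`. -/
def IsFiniteChart (g : GL (Fin 2) K) (Q : P1 (AlgebraicClosure K))
    (f : GL (Fin 2) (AlgebraicClosure K)) (z : AlgebraicClosure K) : Prop :=
  f • affinePoint z = Q ∧ ∀ i : ℕ, (autOnPoints g)^[i] Q ≠ f • infinity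

/-- The ratio `λ₁(φ^m, Q) / λ₁(h^j, Q)`, computed after the coordinate change `f` at the point `z`
that corresponds to `Q`. -/
def lamRatio (φ : RatMap K d) (g : GL (Fin 2) K) (m j : ℕ)
    (f : GL (Fin 2) (AlgebraicClosure K)) (z : AlgebraicClosure K) : AlgebraicClosure K :=
  Pair.lam 1 (Pair.conj f (φ.toPair.iter m).toClosure) z /
    Pair.lam 1 (Pair.conj f (Pair.ofGL (g ^ j)).toClosure) z

end

end HTuned

/-! At a fixed point of h the division by linear forms makes the order zero and changes no other
order (`IsFormQuotient.div_finprod`), so everything happens at a point Q outside Fix(h). There the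
h-orbit of Q has exactly p elements, so at most one of the factors φ^k - h^i of Ψ_{pk} vanishes at
Q. Since φ and h commute, some factor vanishes exactly when k = mn with p ∤ n
(`exists_iterate_eq_iff`).

The order of vanishing is local. With φ^m(Q) = h^j(Q), the germ of h^{-j} φ^m at Q is a substitution
X ↦ s with s(0) = 0, that is, an endomorphism E of the algebra of power series. By commutation E^n
is the germ of h^{-jn} φ^{mn} (`exists_germ`). Hence the order of Ψ_{pmn} at Q is the order a(n) of
E^n(X) - X (`ordAt_Psi_eq_contact`), and the linear coefficient of E(X) is the ratio of the λ₁,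
whose multiplicative order is r (`lamRatio_eq`).

If r ∤ n, the linear term of E^n(X) - X survives and a(n) = 1. If r ∣ n, then E^n is tangent to the
identity, and its k-th power has leading deviation k times that of E^n
(`X_pow_succ_dvd_pow_algHom_sub`). So a(nk) = a(n) when k ≠ 0 in the field, and a(nq) > a(n) ≥ 2 in
characteristic q > 0. Thus a is the divisor sum of a function supported on 1, r and the r q^s, with
s ≥ 1, and positive there. Möbius inversion recovers this function
(`moebius_sum_nonneg_and_pos_iff`), and it is the order of Ψ*_{pN} at Q when N = mn with p ∤ n. For
all other N the condition pk ∤ N leaves no contributing k, and the order is 0.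

All orders are therefore nonnegative. A quotient of forms without poles is a polynomial over the
algebraic closure, by splitting off linear factors (`form_dvd_of_multiplicity_le`), and the
divisibility descends to K (`dvd_of_map_dvd`). -/

namespace HTuned

open MvPolynomial

/-! ### Binary forms: linear factors and multiplicities. -/

section Forms

/-- The constant coefficient as a homomorphism of algebras over a subring of scalars. -/
noncomputable def constantCoeffAlgHom (K L : Type*) [CommRing K] [CommRing L] [Algebra K L] :
    PowerSeries L →ₐ[K] L :=
  { PowerSeries.constantCoeff with
    commutes' := fun r => by simp [PowerSeries.algebraMap_apply] }

@[simp]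
theorem constantCoeffAlgHom_apply {K L : Type*} [CommRing K] [CommRing L] [Algebra K L]
    (f : PowerSeries L) : constantCoeffAlgHom K L f = PowerSeries.constantCoeff f := rfl

variable {L : Type*} [Field L]

/-- The linear form `v₁ x - v₀ y` that vanishes at the vector `v`. -/
noncomputable def lineForm (v : Fin 2 → L) : BinPoly L := C (v 1) * X 0 - C (v 0) * X 1

theorem lineForm_isHomogeneous (v : Fin 2 → L) : (lineForm v).IsHomogeneous 1 :=
  ((isHomogeneous_X _ _).C_mul _).sub ((isHomogeneous_X _ _).C_mul _)

theorem aeval_lineForm {S : Type*} [CommRing S] [Algebra L S] (v : Fin 2 → L) (u : Fin 2 → S) :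
    aeval u (lineForm v) = algebraMap L S (v 1) * u 0 - algebraMap L S (v 0) * u 1 := by
  simp [lineForm]

/-- The ring version of `aeval_smul_of_isHomogeneous`: scalars from polynomial and power series
rings are needed. -/
theorem aeval_smul_form {S : Type*} [CommRing S] [Algebra L S] {A : BinPoly L} {d : ℕ}
    (hA : A.IsHomogeneous d) (a : S) (v : Fin 2 → S) :
    aeval (a • v) A = a ^ d * aeval v A := by
  rw [aeval_def, aeval_def, eval₂_eq', eval₂_eq', Finset.mul_sum]
  refine Finset.sum_congr rfl fun m hm => ?_
  have h := hA (mem_support_iff.mp hm)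
  rw [Finsupp.weight_apply, Finsupp.sum_fintype _ _ (by simp)] at h
  simp only [Pi.one_apply, smul_eq_mul, mul_one] at h
  simp only [Pi.smul_apply, smul_eq_mul, mul_pow, Finset.prod_mul_distrib,
    Finset.prod_pow_eq_pow_sum, h]
  ring

theorem exists_dual_vector {v : Fin 2 → L} (hv : v ≠ 0) :
    ∃ w : Fin 2 → L, w 0 * v 0 + w 1 * v 1 = 1 := by
  by_cases h : v 0 = 0
  · have h1 : v 1 ≠ 0 := fun h1 => hv (by funext i; fin_cases i <;> assumption)
    exact ⟨![0, (v 1)⁻¹], by simp [h1]⟩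
  · exact ⟨![(v 0)⁻¹, 0], by simp [h]⟩

/-- Modulo the linear form, each variable equals v_i l, where l = w₀x + w₁y and w is dual to v. So
substituting T v_i for the variables loses nothing modulo the linear form. As L[T] is a domain,
primality of the linear form follows. -/
theorem lineForm_dvd_iff {v : Fin 2 → L} (hv : v ≠ 0) (A : BinPoly L) :
    lineForm v ∣ A ↔
      aeval (fun i => Polynomial.C (v i) * Polynomial.X : Fin 2 → Polynomial L) A = 0 := by
  constructor
  · rintro ⟨B, rfl⟩
    rw [map_mul, aeval_lineForm]
    simp only [Polynomial.algebraMap_eq]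
    ring
  · intro h
    obtain ⟨w, hw⟩ := exists_dual_vector hv
    set I : Ideal (BinPoly L) := Ideal.span {lineForm v} with hI
    rw [← Ideal.mem_span_singleton, ← Ideal.Quotient.eq_zero_iff_mem]
    set l : BinPoly L := C (w 0) * X 0 + C (w 1) * X 1 with hl
    have hwC : (C (w 0) * C (v 0) + C (w 1) * C (v 1) : BinPoly L) = 1 := by
      rw [← C_mul, ← C_mul, ← C_add, hw, C_1]
    have key : ∀ i, (Ideal.Quotient.mk I) (C (v i) * l) = Ideal.Quotient.mk I (X i) := by
      intro i
      rw [Ideal.Quotient.eq, Ideal.mem_span_singleton]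
      fin_cases i
      · refine ⟨-C (w 1), ?_⟩
        simp only [Fin.zero_eta, hl, lineForm]
        linear_combination (X 0 : BinPoly L) * hwC
      · refine ⟨C (w 0), ?_⟩
        simp only [Fin.mk_one, hl, lineForm]
        linear_combination (X 1 : BinPoly L) * hwC
    have h1 := congrArg (fun P => Ideal.Quotient.mk I (Polynomial.aeval l P)) h
    simp only [map_zero] at h1
    rw [← h1]
    change _ = (((Ideal.Quotient.mkₐ L I).comp (Polynomial.aeval l)).comp (aeval _)) A
    change (Ideal.Quotient.mkₐ L I) A = _
    congr 1
    ext i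
    simp only [AlgHom.comp_apply, aeval_X, map_mul, Polynomial.aeval_C, Polynomial.aeval_X]
    have := key i
    rw [map_mul] at this
    exact this.symm

theorem prime_lineForm {v : Fin 2 → L} (hv : v ≠ 0) : Prime (lineForm v) := by
  refine ⟨?_, ?_, ?_⟩
  · intro h
    apply hv
    have h0 := congrArg (aeval (![1, 0] : Fin 2 → L)) h
    have h1 := congrArg (aeval (![0, 1] : Fin 2 → L)) h
    rw [aeval_lineForm] at h0 h1
    simp at h0 h1
    funext i; fin_cases i <;> assumption
  · intro h
    have h2 : lineForm v ∣ 1 := isUnit_iff_dvd_one.mp h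
    rw [lineForm_dvd_iff hv] at h2
    simp at h2
  · intro A B h
    simp only [lineForm_dvd_iff hv, map_mul, mul_eq_zero] at h ⊢
    exact h

theorem lineForm_dvd_iff_of_isHomogeneous {v : Fin 2 → L} (hv : v ≠ 0) {A : BinPoly L} {n : ℕ}
    (hA : A.IsHomogeneous n) : lineForm v ∣ A ↔ aeval v A = 0 := by
  rw [lineForm_dvd_iff hv]
  have h : (fun i => Polynomial.C (v i) * Polynomial.X : Fin 2 → Polynomial L) =
      (Polynomial.X : Polynomial L) • fun i => algebraMap L (Polynomial L) (v i) := by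
    funext i
    simp only [Pi.smul_apply, smul_eq_mul, Polynomial.algebraMap_eq, mul_comm]
  have h2 : aeval (fun i => algebraMap L (Polynomial L) (v i)) A =
      algebraMap L (Polynomial L) (aeval v A) := aeval_algebraMap_apply _ _ _
  rw [h, aeval_smul_form hA, h2]
  simp

/-- Replacing any cofactor by its component of degree n keeps it a form, which the inductions on the
degree require. -/
theorem exists_form_eq_lineForm_mul {v : Fin 2 → L} (hv : v ≠ 0) {A : BinPoly L} {n : ℕ}
    (hA : A.IsHomogeneous (n + 1)) (h : aeval v A = 0) :
    ∃ B : BinPoly L, B.IsHomogeneous n ∧ A = lineForm v * B := by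
  obtain ⟨B, rfl⟩ := (lineForm_dvd_iff_of_isHomogeneous hv hA).mpr h
  refine ⟨homogeneousComponent n B, homogeneousComponent_isHomogeneous _ _, ?_⟩
  have h1 : homogeneousComponent (n + 1) (lineForm v * B) = lineForm v * B :=
    homogeneousComponent_eq_self hA
  rw [← h1]
  conv_lhs => rw [← sum_homogeneousComponent B, Finset.mul_sum, map_sum]
  have h2 : ∀ i, homogeneousComponent (n + 1) (lineForm v * homogeneousComponent i B) =
      if i = n then lineForm v * homogeneousComponent n B else 0 := by
    intro i
    have h3 : (lineForm v * homogeneousComponent i B).IsHomogeneous (1 + i) :=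
      (lineForm_isHomogeneous v).mul (homogeneousComponent_isHomogeneous _ _)
    rw [homogeneousComponent_of_mem h3]
    by_cases hi : i = n
    · subst hi; simp [add_comm]
    · rw [if_neg hi, if_neg (by omega)]
  simp only [h2, Finset.sum_ite_eq', Finset.mem_range]
  split_ifs with h4
  · rfl
  · rw [homogeneousComponent_eq_zero _ _ (by omega), mul_zero]

/-- Without zeros, A(1, t) and A(t, 1) are constant, equal to the same c = A(1, 1) ≠ 0. Then A(1, y)
= y^n A(1/y, 1) gives y^n = 1 for all y ≠ 0, which fails for an n-th root of any element other than
0 and 1. -/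
theorem exists_zero_form [IsAlgClosed L] {A : BinPoly L} {n : ℕ} (hn : n ≠ 0)
    (hA : A.IsHomogeneous n) : ∃ v : Fin 2 → L, v ≠ 0 ∧ aeval v A = 0 := by
  by_contra! hne
  have hconst : ∀ u : Fin 2 → Polynomial L, (∀ t, (fun i => (u i).eval t) ≠ 0) →
      ∃ c, ∀ t, aeval (fun i => (u i).eval t) A = c := by
    intro u hu
    have hpoly : ∀ t : L, (aeval u A).eval t = aeval (fun i => (u i).eval t) A := by
      intro t
      simp only [← Polynomial.coe_aeval_eq_eval]
      exact comp_aeval_apply _ (Polynomial.aeval t) A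
    have hdeg : (aeval u A).degree = 0 := by
      by_contra hd
      obtain ⟨t, ht⟩ := IsAlgClosed.exists_root _ hd
      exact hne _ (hu t) ((hpoly t).symm.trans ht)
    rw [Polynomial.eq_C_of_degree_eq_zero hdeg] at hpoly
    exact ⟨_, fun t => (hpoly t).symm.trans (Polynomial.eval_C ..)⟩
  obtain ⟨c, hc⟩ := hconst ![1, Polynomial.X] fun t h => by simpa using congrFun h 0
  obtain ⟨c', hc'⟩ := hconst ![Polynomial.X, 1] fun t h => by simpa using congrFun h 1
  have e1 : ∀ t : L, (fun i => ((![1, Polynomial.X] : Fin 2 → Polynomial L) i).eval t) =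
      ![1, t] := by
    intro t; funext i; fin_cases i <;> simp
  have e2 : ∀ t : L, (fun i => ((![Polynomial.X, 1] : Fin 2 → Polynomial L) i).eval t) =
      ![t, 1] := by
    intro t; funext i; fin_cases i <;> simp
  simp only [e1] at hc
  simp only [e2] at hc'
  have hcc : c = c' := (hc 1).symm.trans (hc' 1)
  have hc0 : c ≠ 0 := by
    rw [← hc 0]
    exact hne _ fun h => by simpa using congrFun h 0
  have hpow : ∀ y : L, y ≠ 0 → y ^ n = 1 := by
    intro y hy
    have h1 : (![1, y] : Fin 2 → L) = y • ![y⁻¹, 1] := by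
      funext i; fin_cases i <;> simp [hy]
    have h2 := hc y
    rw [h1, aeval_smul_form hA, hc', ← hcc] at h2
    exact mul_right_cancel₀ hc0 (h2.trans (one_mul c).symm)
  classical
  obtain ⟨t, ht⟩ := Infinite.exists_notMem_finset ({0, 1} : Finset L)
  simp only [Finset.mem_insert, Finset.mem_singleton, not_or] at ht
  obtain ⟨y, hy⟩ := IsAlgClosed.exists_pow_nat_eq t (Nat.pos_of_ne_zero hn)
  refine ht.2 (hy ▸ hpow y ?_)
  rintro rfl
  rw [zero_pow hn] at hy
  exact ht.1 hy.symm

theorem multiplicity_lineForm_mul {v : Fin 2 → L} (hv : v ≠ 0) {A B : BinPoly L}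
    (hA : A ≠ 0) (hB : B ≠ 0) : multiplicity (lineForm v) (A * B) =
      multiplicity (lineForm v) A + multiplicity (lineForm v) B :=
  multiplicity_mul (prime_lineForm hv)
    (FiniteMultiplicity.of_prime_left (prime_lineForm hv) (mul_ne_zero hA hB))

theorem multiplicity_lineForm_eq_zero {v : Fin 2 → L} (hv : v ≠ 0) {A : BinPoly L} {n : ℕ}
    (hA : A.IsHomogeneous n) (h : aeval v A ≠ 0) : multiplicity (lineForm v) A = 0 :=
  multiplicity_eq_zero.mpr (mt (lineForm_dvd_iff_of_isHomogeneous hv hA).mp h)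

/-- The multiplicity of a form at `v` is its order along any line through `v` in the plane that is
not spanned by `v`. -/
theorem multiplicity_lineForm_eq_order {v w : Fin 2 → L} (hv : v ≠ 0)
    (hw : v 1 * w 0 - v 0 * w 1 ≠ 0) {n : ℕ} {A : BinPoly L} (hA : A.IsHomogeneous n) (h0 : A ≠ 0) :
    (multiplicity (lineForm v) A : ℕ∞) =
      (aeval (fun i => PowerSeries.C (v i) + PowerSeries.C (w i) * PowerSeries.X :
        Fin 2 → PowerSeries L) A).order := by
  induction n generalizing A with
  | zero =>
    obtain ⟨c, rfl⟩ : ∃ c, A = C c :=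
      ⟨_, totalDegree_eq_zero_iff_eq_C.mp (Nat.le_zero.mp hA.totalDegree_le)⟩
    have hc : c ≠ 0 := by simpa using h0
    rw [multiplicity_lineForm_eq_zero hv hA (by simpa using hc), aeval_C]
    have : IsUnit (algebraMap L (PowerSeries L) c) := (IsUnit.mk0 c hc).map _
    rw [PowerSeries.order_zero_of_unit this]
    simp
  | succ n ih =>
    by_cases h : aeval v A = 0
    · obtain ⟨B, hB, rfl⟩ := exists_form_eq_lineForm_mul hv hA h
      have hB0 : B ≠ 0 := right_ne_zero_of_mul h0
      classical
      rw [multiplicity_lineForm_mul hv (left_ne_zero_of_mul h0) hB0, multiplicity_self,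
        map_mul, PowerSeries.order_mul, ← ih hB hB0, aeval_lineForm]
      have : algebraMap L (PowerSeries L) (v 1) *
            (PowerSeries.C (v 0) + PowerSeries.C (w 0) * PowerSeries.X) -
          algebraMap L (PowerSeries L) (v 0) *
            (PowerSeries.C (v 1) + PowerSeries.C (w 1) * PowerSeries.X) =
          PowerSeries.C (v 1 * w 0 - v 0 * w 1) * PowerSeries.X := by
        rw [PowerSeries.algebraMap_eq]
        simp only [map_sub, map_mul]
        ring
      rw [this, PowerSeries.order_mul, PowerSeries.order_X,
        PowerSeries.order_zero_of_unit ((IsUnit.mk0 _ hw).map _)]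
      simp
    · rw [multiplicity_lineForm_eq_zero hv hA h]
      symm
      rw [Nat.cast_zero]
      by_contra hne
      rw [← ne_eq, PowerSeries.order_ne_zero_iff_constCoeff_eq_zero] at hne
      apply h
      rw [← constantCoeffAlgHom_apply (K := L), comp_aeval_apply] at hne
      rw [← hne]
      congr 2
      funext i
      simp

/-- Linear factors of B are cancelled one at a time; only B has to be a form. -/
theorem form_dvd_of_multiplicity_le [IsAlgClosed L] {n : ℕ} {B : BinPoly L} (hB : B.IsHomogeneous n)
    (hB0 : B ≠ 0) {A : BinPoly L} (hA0 : A ≠ 0)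
    (h : ∀ v : Fin 2 → L, v ≠ 0 → multiplicity (lineForm v) B ≤ multiplicity (lineForm v) A) :
    B ∣ A := by
  classical
  induction n generalizing A B with
  | zero =>
    obtain ⟨c, rfl⟩ : ∃ c, B = C c :=
      ⟨_, totalDegree_eq_zero_iff_eq_C.mp (Nat.le_zero.mp hB.totalDegree_le)⟩
    have hc : c ≠ 0 := by simpa using hB0
    exact ((IsUnit.mk0 c hc).map C).dvd
  | succ n ih =>
    obtain ⟨v, hv, hvB⟩ := exists_zero_form n.succ_ne_zero hB
    obtain ⟨B, hB', rfl⟩ := exists_form_eq_lineForm_mul hv hB hvB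
    have hBn := right_ne_zero_of_mul hB0
    have hl := left_ne_zero_of_mul hB0
    obtain ⟨A, rfl⟩ : lineForm v ∣ A := by
      have h1 := h v hv
      rw [multiplicity_lineForm_mul hv hl hBn, multiplicity_self] at h1
      exact dvd_of_multiplicity_pos (by omega)
    have hAn := right_ne_zero_of_mul hA0
    refine mul_dvd_mul_left _ (ih hB' hBn hAn fun u hu => ?_)
    have h1 := h u hu
    rw [multiplicity_lineForm_mul hu hl hBn, multiplicity_lineForm_mul hu hl hAn] at h1
    omega

theorem multiplicity_lineForm_smul {v : Fin 2 → L} {a : L} (ha : a ≠ 0) (A : BinPoly L) :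
    multiplicity (lineForm (a • v)) A = multiplicity (lineForm v) A := by
  apply multiplicity_eq_of_associated_left
  have : lineForm (a • v) = lineForm v * C a := by
    simp only [lineForm, Pi.smul_apply, smul_eq_mul, map_mul]; ring
  obtain ⟨u, hu⟩ := (IsUnit.mk0 a ha).map (C : L →+* BinPoly L)
  exact ⟨u, by rw [hu, this]⟩

end Forms

/-! ### Descent of divisibility to the ground field. -/

section Descent

variable {K L : Type*} [Field K] [Field L] [Algebra K L]

/-- Divisibility of polynomials descends along field extensions. -/
theorem dvd_of_map_dvd {σ : Type*} {A B : MvPolynomial σ K}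
    (h : map (algebraMap K L) B ∣ map (algebraMap K L) A) : B ∣ A := by
  obtain ⟨D, hD⟩ := h
  -- A K-linear retraction of L onto K. Applied to the coefficients of the cofactor, it respects the
  -- product because the coefficients of B lie in K.
  obtain ⟨ρ, hρ⟩ := (Algebra.linearMap K L).exists_leftInverse_of_injective
    (LinearMap.ker_eq_bot.mpr (algebraMap K L).injective)
  have hρ1 : ∀ a, ρ (algebraMap K L a) = a := fun a => LinearMap.congr_fun hρ a
  classical
  have hcoeff : ∀ m, coeff m (∑ n ∈ D.support, monomial n (ρ (coeff n D))) = ρ (coeff m D) := by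
    intro m
    simp only [coeff_sum, coeff_monomial, Finset.sum_ite_eq', mem_support_iff]
    split_ifs with h
    · rfl
    · rw [not_not.mp h, map_zero]
  refine ⟨∑ n ∈ D.support, monomial n (ρ (coeff n D)), ?_⟩
  ext m
  have h1 := congrArg (fun P => ρ (coeff m P)) hD
  simp only [coeff_map, hρ1, coeff_mul, map_sum] at h1
  rw [h1, coeff_mul]
  refine Finset.sum_congr rfl fun x _ => ?_
  rw [← Algebra.smul_def, map_smul, smul_eq_mul, hcoeff]

end Descent

end HTuned

namespace HTuned

open MvPolynomial

/-! ### Orders of rational functions at points. -/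

section Order

variable {K : Type*} [Field K]

/-- Extension of scalars of binary polynomials to the algebraic closure. -/
noncomputable abbrev extend (A : BinPoly K) : BinPoly (AlgebraicClosure K) :=
  map (algebraMap K (AlgebraicClosure K)) A

theorem extend_ne_zero {A : BinPoly K} (hA : A ≠ 0) : extend A ≠ 0 :=
  (map_ne_zero_iff _ (map_injective _ (algebraMap K (AlgebraicClosure K)).injective)).mpr hA

theorem aeval_extend {S : Type*} [CommRing S] [Algebra (AlgebraicClosure K) S] [Algebra K S]
    [IsScalarTower K (AlgebraicClosure K) S] (u : Fin 2 → S) (A : BinPoly K) :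
    aeval u (extend A) = aeval u A :=
  aeval_map_algebraMap _ _ _

/-- Frees `ordAt` from the reduced fraction in its definition: cross-multiplying and adding
multiplicities at the prime linear form allows any fraction. -/
theorem ordAt_div (Q : P1 (AlgebraicClosure K)) {A B : BinPoly K} (hA : A ≠ 0) (hB : B ≠ 0) :
    ordAt Q (algebraMap (BinPoly K) (RatFun K) A / algebraMap (BinPoly K) (RatFun K) B) =
      multiplicity (linForm Q) (extend A) - multiplicity (linForm Q) (extend B) := by
  set f := algebraMap (BinPoly K) (RatFun K) A / algebraMap (BinPoly K) (RatFun K) B with hf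
  have hinj := IsFractionRing.injective (BinPoly K) (RatFun K)
  have hA' : algebraMap (BinPoly K) (RatFun K) A ≠ 0 := (map_ne_zero_iff _ hinj).mpr hA
  have hB' : algebraMap (BinPoly K) (RatFun K) B ≠ 0 := (map_ne_zero_iff _ hinj).mpr hB
  have hden : (IsFractionRing.den (BinPoly K) f : BinPoly K) ≠ 0 :=
    nonZeroDivisors.coe_ne_zero _
  have hden' : algebraMap (BinPoly K) (RatFun K) (IsFractionRing.den (BinPoly K) f) ≠ 0 :=
    (map_ne_zero_iff _ hinj).mpr hden
  have hmul : IsFractionRing.num (BinPoly K) f * B = A * IsFractionRing.den (BinPoly K) f := by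
    apply hinj
    have h1 : algebraMap (BinPoly K) (RatFun K) (IsFractionRing.num (BinPoly K) f) /
        algebraMap (BinPoly K) (RatFun K) (IsFractionRing.den (BinPoly K) f) = f := by
      rw [← IsFractionRing.mk'_eq_div, IsFractionRing.mk'_num_den]
    rw [hf, div_eq_div_iff hden' hB'] at h1
    rw [map_mul, map_mul]
    exact h1
  have hnum : IsFractionRing.num (BinPoly K) f ≠ 0 := by
    intro h
    rw [h, zero_mul] at hmul
    exact mul_ne_zero hA hden hmul.symm
  have h2 := congrArg (fun P => multiplicity (linForm Q) (extend P)) hmul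
  have hQ := Q.rep_nonzero
  simp only [extend, map_mul] at h2
  change multiplicity (lineForm Q.rep) _ = multiplicity (lineForm Q.rep) _ at h2
  rw [multiplicity_lineForm_mul hQ (extend_ne_zero hnum) (extend_ne_zero hB),
    multiplicity_lineForm_mul hQ (extend_ne_zero hA) (extend_ne_zero hden)] at h2
  change (multiplicity (lineForm Q.rep) _ : ℤ) - multiplicity (lineForm Q.rep) _ =
    multiplicity (lineForm Q.rep) _ - multiplicity (lineForm Q.rep) _
  unfold extend at h2 ⊢
  omega

theorem exists_eq_div_of_ne_zero {f : RatFun K} (hf : f ≠ 0) : ∃ A B : BinPoly K, A ≠ 0 ∧ B ≠ 0 ∧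
    f = algebraMap (BinPoly K) (RatFun K) A / algebraMap (BinPoly K) (RatFun K) B := by
  obtain ⟨A, B, hB, rfl⟩ := IsFractionRing.div_surjective (A := BinPoly K) f
  refine ⟨A, B, ?_, nonZeroDivisors.ne_zero hB, rfl⟩
  rintro rfl
  simp at hf

theorem ordAt_algebraMap (Q : P1 (AlgebraicClosure K)) {A : BinPoly K} (hA : A ≠ 0) :
    ordAt Q (algebraMap (BinPoly K) (RatFun K) A) = multiplicity (linForm Q) (extend A) := by
  have h := ordAt_div Q hA (one_ne_zero (α := BinPoly K))
  rw [map_one, div_one] at h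
  have h1 : extend (1 : BinPoly K) = 1 := map_one _
  rw [h, h1]
  have : multiplicity (linForm Q) 1 = 0 :=
    multiplicity_eq_zero.mpr fun h =>
      (prime_lineForm Q.rep_nonzero).not_isUnit (isUnit_iff_dvd_one.mpr h)
  simp [this]

theorem ordAt_mul (Q : P1 (AlgebraicClosure K)) {f₁ f₂ : RatFun K} (h₁ : f₁ ≠ 0) (h₂ : f₂ ≠ 0) :
    ordAt Q (f₁ * f₂) = ordAt Q f₁ + ordAt Q f₂ := by
  obtain ⟨A, B, hA, hB, rfl⟩ := exists_eq_div_of_ne_zero h₁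
  obtain ⟨C, D, hC, hD, rfl⟩ := exists_eq_div_of_ne_zero h₂
  rw [div_mul_div_comm, ← map_mul, ← map_mul, ordAt_div Q (mul_ne_zero hA hC) (mul_ne_zero hB hD),
    ordAt_div Q hA hB, ordAt_div Q hC hD]
  have e1 : multiplicity (linForm Q) (extend (A * C)) =
      multiplicity (linForm Q) (extend A) + multiplicity (linForm Q) (extend C) := by
    rw [extend, map_mul]
    exact multiplicity_lineForm_mul Q.rep_nonzero (extend_ne_zero hA) (extend_ne_zero hC)
  have e2 : multiplicity (linForm Q) (extend (B * D)) =
      multiplicity (linForm Q) (extend B) + multiplicity (linForm Q) (extend D) := by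
    rw [extend, map_mul]
    exact multiplicity_lineForm_mul Q.rep_nonzero (extend_ne_zero hB) (extend_ne_zero hD)
  rw [e1, e2]
  push_cast
  ring

/-- `ordAt Q` as a homomorphism from the multiplicative group of the field of rational functions. -/
noncomputable def ordAtHom (Q : P1 (AlgebraicClosure K)) : (RatFun K)ˣ →* Multiplicative ℤ :=
  MonoidHom.mk' (fun f => Multiplicative.ofAdd (ordAt Q (f : RatFun K))) fun f₁ f₂ => by
    rw [Units.val_mul, ordAt_mul Q f₁.ne_zero f₂.ne_zero, ofAdd_add]

theorem ordAt_zpow (Q : P1 (AlgebraicClosure K)) {f : RatFun K} (hf : f ≠ 0) (n : ℤ) :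
    ordAt Q (f ^ n) = n * ordAt Q f := by
  have h := congrArg Multiplicative.toAdd (map_zpow (ordAtHom Q) (Units.mk0 f hf) n)
  simpa [ordAtHom] using h

theorem ordAt_div_of_ne_zero (Q : P1 (AlgebraicClosure K)) {f₁ f₂ : RatFun K} (h₁ : f₁ ≠ 0)
    (h₂ : f₂ ≠ 0) : ordAt Q (f₁ / f₂) = ordAt Q f₁ - ordAt Q f₂ := by
  rw [div_eq_mul_inv, ← zpow_neg_one, ordAt_mul Q h₁ (zpow_ne_zero _ h₂), ordAt_zpow Q h₂]
  ring

theorem ordAt_prod (Q : P1 (AlgebraicClosure K)) {ι : Type*} (s : Finset ι) (f : ι → RatFun K)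
    (hf : ∀ i ∈ s, f i ≠ 0) : ordAt Q (∏ i ∈ s, f i) = ∑ i ∈ s, ordAt Q (f i) := by
  classical
  induction s using Finset.induction_on with
  | empty => simpa using ordAt_zpow Q (one_ne_zero (α := RatFun K)) 0
  | insert a s ha ih =>
    have h1 := hf a (Finset.mem_insert_self _ _)
    have h2 := fun i hi => hf i (Finset.mem_insert_of_mem hi)
    rw [Finset.prod_insert ha, Finset.sum_insert ha,
      ordAt_mul Q h1 (Finset.prod_ne_zero_iff.mpr h2), ih h2]

/-- Quotients of nonzero binary forms. -/
def IsFormQuotient (f : RatFun K) : Prop :=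
  ∃ (A B : BinPoly K) (m n : ℕ), A.IsHomogeneous m ∧ B.IsHomogeneous n ∧ A ≠ 0 ∧ B ≠ 0 ∧
    f = algebraMap (BinPoly K) (RatFun K) A / algebraMap (BinPoly K) (RatFun K) B

theorem IsFormQuotient.ne_zero {f : RatFun K} (hf : IsFormQuotient f) : f ≠ 0 := by
  obtain ⟨A, B, _, _, _, _, hA, hB, rfl⟩ := hf
  have hinj := IsFractionRing.injective (BinPoly K) (RatFun K)
  exact div_ne_zero ((map_ne_zero_iff _ hinj).mpr hA) ((map_ne_zero_iff _ hinj).mpr hB)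

theorem IsFormQuotient.of_form {A : BinPoly K} {n : ℕ} (hA : A.IsHomogeneous n) (h0 : A ≠ 0) :
    IsFormQuotient (algebraMap (BinPoly K) (RatFun K) A) :=
  ⟨A, 1, n, 0, hA, isHomogeneous_one _ _, h0, one_ne_zero, by simp⟩

theorem IsFormQuotient.one : IsFormQuotient (1 : RatFun K) :=
  ⟨1, 1, 0, 0, isHomogeneous_one _ _, isHomogeneous_one _ _, one_ne_zero, one_ne_zero, by simp⟩

theorem IsFormQuotient.mul {f₁ f₂ : RatFun K} (h₁ : IsFormQuotient f₁) (h₂ : IsFormQuotient f₂) :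
    IsFormQuotient (f₁ * f₂) := by
  obtain ⟨A, B, m, n, hA, hB, hA0, hB0, rfl⟩ := h₁
  obtain ⟨C, D, m', n', hC, hD, hC0, hD0, rfl⟩ := h₂
  exact ⟨A * C, B * D, _, _, hA.mul hC, hB.mul hD, mul_ne_zero hA0 hC0, mul_ne_zero hB0 hD0, by
    rw [div_mul_div_comm, map_mul, map_mul]⟩

theorem IsFormQuotient.inv {f : RatFun K} (h : IsFormQuotient f) : IsFormQuotient f⁻¹ := by
  obtain ⟨A, B, m, n, hA, hB, hA0, hB0, rfl⟩ := h
  exact ⟨B, A, _, _, hB, hA, hB0, hA0, inv_div _ _⟩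

theorem IsFormQuotient.zpow {f : RatFun K} (h : IsFormQuotient f) (n : ℤ) :
    IsFormQuotient (f ^ n) := by
  have hpow : ∀ k : ℕ, IsFormQuotient (f ^ k) := by
    intro k
    induction k with
    | zero => simpa using IsFormQuotient.one
    | succ k ih => rw [pow_succ]; exact ih.mul h
  cases n with
  | ofNat k => simpa using hpow k
  | negSucc k => rw [zpow_negSucc]; exact (hpow _).inv

theorem IsFormQuotient.prod {ι : Type*} (s : Finset ι) (f : ι → RatFun K)
    (hf : ∀ i ∈ s, IsFormQuotient (f i)) : IsFormQuotient (∏ i ∈ s, f i) :=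
  Finset.prod_induction _ _ (fun _ _ => IsFormQuotient.mul) IsFormQuotient.one hf

/-- A quotient of forms without poles is a polynomial. -/
theorem IsFormQuotient.exists_eq_algebraMap {f : RatFun K} (hf : IsFormQuotient f)
    (h : ∀ Q, 0 ≤ ordAt Q f) : ∃ A : BinPoly K, f = algebraMap (BinPoly K) (RatFun K) A := by
  obtain ⟨A, B, m, n, hA, hB, hA0, hB0, rfl⟩ := hf
  have hdvd : B ∣ A := by
    refine dvd_of_map_dvd (L := AlgebraicClosure K) ?_
    refine form_dvd_of_multiplicity_le (hB.map _) (extend_ne_zero hB0) (extend_ne_zero hA0) ?_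
    intro v hv
    have hQ := h (Projectivization.mk _ v hv)
    rw [ordAt_div _ hA0 hB0] at hQ
    obtain ⟨a, ha⟩ := Projectivization.exists_smul_eq_mk_rep (AlgebraicClosure K) v hv
    have hlin : linForm (Projectivization.mk _ v hv) = lineForm ((a : AlgebraicClosure K) • v) := by
      rw [← Units.smul_def, ha]; rfl
    rw [hlin, multiplicity_lineForm_smul a.ne_zero, multiplicity_lineForm_smul a.ne_zero] at hQ
    unfold extend at hQ
    omega
  obtain ⟨C, rfl⟩ := hdvd
  refine ⟨C, ?_⟩
  rw [map_mul, mul_div_cancel_left₀]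
  exact (map_ne_zero_iff _ (IsFractionRing.injective (BinPoly K) (RatFun K))).mpr hB0

end Order

end HTuned

namespace HTuned

open MvPolynomial

/-! ### Evaluation of pairs and matrices on vectors over an algebra. -/

section Evaluation

variable {K : Type*} [Field K] {S : Type*} [CommRing S] [Algebra K S]

/-- The value of a pair of polynomials at a vector over a `K`-algebra. -/
noncomputable def evalPair (Φ : Pair K) (u : Fin 2 → S) : Fin 2 → S := fun i => aeval u (Φ i)

/-- The action of `GL₂(K)` on vectors over a `K`-algebra. -/
noncomputable def act (g : GL (Fin 2) K) (u : Fin 2 → S) : Fin 2 → S :=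
  Matrix.mulVec (g.map (algebraMap K S) : GL (Fin 2) S).val u

/-- The determinant of two vectors. -/
def wedge (a b : Fin 2 → S) : S := a 0 * b 1 - a 1 * b 0

theorem act_apply (g : GL (Fin 2) K) (u : Fin 2 → S) (i : Fin 2) :
    act g u i = algebraMap K S (g i 0) * u 0 + algebraMap K S (g i 1) * u 1 := by
  simp [act, Matrix.mulVec, dotProduct, Fin.sum_univ_two]

theorem act_one (u : Fin 2 → S) : act (1 : GL (Fin 2) K) u = u := by
  simp [act]

theorem act_mul (g h : GL (Fin 2) K) (u : Fin 2 → S) : act (g * h) u = act g (act h u) := by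
  simp only [act, map_mul, Units.val_mul, Matrix.mulVec_mulVec]

theorem act_smul (g : GL (Fin 2) K) (c : S) (u : Fin 2 → S) : act g (c • u) = c • act g u := by
  simp [act, Matrix.mulVec_smul]

theorem wedge_smul_left (c : S) (a b : Fin 2 → S) : wedge (c • a) b = c * wedge a b := by
  simp only [wedge, Pi.smul_apply, smul_eq_mul]; ring

theorem wedge_act (g : GL (Fin 2) K) (a b : Fin 2 → S) :
    wedge (act g a) (act g b) = algebraMap K S g.val.det * wedge a b := by
  rw [Matrix.det_fin_two]
  simp only [wedge, act_apply, map_sub, map_mul]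
  ring

theorem evalPair_comp (Φ Θ : Pair K) (u : Fin 2 → S) :
    evalPair (Pair.comp Φ Θ) u = evalPair Φ (evalPair Θ u) := by
  funext i
  exact aeval_bind₁ _ _ _

theorem evalPair_X (u : Fin 2 → S) : evalPair (X : Pair K) u = u := by
  funext i; simp [evalPair]

theorem evalPair_iter_zero (Φ : Pair K) (u : Fin 2 → S) : evalPair (Φ.iter 0) u = u :=
  evalPair_X u

theorem evalPair_iter_succ (Φ : Pair K) (n : ℕ) (u : Fin 2 → S) :
    evalPair (Φ.iter (n + 1)) u = evalPair Φ (evalPair (Φ.iter n) u) :=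
  evalPair_comp _ _ _

theorem evalPair_iter_add (Φ : Pair K) (m n : ℕ) (u : Fin 2 → S) :
    evalPair (Φ.iter (m + n)) u = evalPair (Φ.iter m) (evalPair (Φ.iter n) u) := by
  induction m with
  | zero => rw [Nat.zero_add, evalPair_iter_zero]
  | succ m ih => rw [Nat.succ_add, evalPair_iter_succ, ih, evalPair_iter_succ]

theorem evalPair_ofGL (g : GL (Fin 2) K) (u : Fin 2 → S) :
    evalPair (Pair.ofGL g) u = act g u := by
  funext i
  rw [act_apply]
  simp [evalPair, Pair.ofGL, Fin.sum_univ_two]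

theorem aeval_cross (Φ Θ : Pair K) (u : Fin 2 → S) :
    aeval u (Pair.cross Φ Θ) = wedge (evalPair Φ u) (evalPair Θ u) := by
  simp [Pair.cross, wedge, evalPair]

theorem evalPair_smul {Φ : Pair K} {d : ℕ} (hΦ : ∀ i, (Φ i).IsHomogeneous d) (c : S)
    (u : Fin 2 → S) : evalPair Φ (c • u) = c ^ d • evalPair Φ u := by
  funext i
  exact aeval_smul_form (hΦ i) c u

theorem map_evalPair {S' : Type*} [CommRing S'] [Algebra K S'] (f : S →ₐ[K] S') (Φ : Pair K)
    (u : Fin 2 → S) : (fun i => f (evalPair Φ u i)) = evalPair Φ fun i => f (u i) := by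
  funext i
  exact comp_aeval_apply _ f _

theorem map_act {S' : Type*} [CommRing S'] [Algebra K S'] (f : S →ₐ[K] S') (g : GL (Fin 2) K)
    (u : Fin 2 → S) : (fun i => f (act g u i)) = act g fun i => f (u i) := by
  rw [← evalPair_ofGL, ← evalPair_ofGL, map_evalPair]

theorem comp_isHomogeneous {Φ Θ : Pair K} {m n : ℕ} (hΦ : ∀ i, (Φ i).IsHomogeneous m)
    (hΘ : ∀ i, (Θ i).IsHomogeneous n) (i : Fin 2) :
    (Pair.comp Φ Θ i).IsHomogeneous (n * m) :=
  (hΦ i).aeval Θ hΘ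

theorem iter_isHomogeneous {Φ : Pair K} {d : ℕ} (hΦ : ∀ i, (Φ i).IsHomogeneous d) (n : ℕ)
    (i : Fin 2) : (Φ.iter n i).IsHomogeneous (d ^ n) := by
  induction n generalizing i with
  | zero => exact isHomogeneous_X _ _
  | succ n ih => rw [pow_succ]; exact comp_isHomogeneous hΦ ih i

theorem ofGL_isHomogeneous (g : GL (Fin 2) K) (i : Fin 2) :
    (Pair.ofGL g i).IsHomogeneous 1 :=
  IsHomogeneous.sum _ _ _ fun _ _ => (isHomogeneous_X _ _).C_mul _

theorem cross_isHomogeneous {Φ Θ : Pair K} {m n : ℕ} (hΦ : ∀ i, (Φ i).IsHomogeneous m)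
    (hΘ : ∀ i, (Θ i).IsHomogeneous n) : (Pair.cross Φ Θ).IsHomogeneous (m + n) :=
  ((hΦ 0).mul (hΘ 1)).sub ((hΦ 1).mul (hΘ 0))

/-- Two vectors over `S` agree up to multiplication by a unit. -/
def SameLine (a b : Fin 2 → S) : Prop := ∃ c : S, IsUnit c ∧ a = c • b

theorem SameLine.refl (a : Fin 2 → S) : SameLine a a := ⟨1, isUnit_one, (one_smul _ _).symm⟩

theorem SameLine.symm {a b : Fin 2 → S} (h : SameLine a b) : SameLine b a := by
  obtain ⟨c, ⟨u, rfl⟩, rfl⟩ := h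
  exact ⟨↑u⁻¹, u⁻¹.isUnit, by rw [smul_smul, Units.inv_mul, one_smul]⟩

theorem SameLine.trans {a b c : Fin 2 → S} (h₁ : SameLine a b) (h₂ : SameLine b c) :
    SameLine a c := by
  obtain ⟨x, hx, rfl⟩ := h₁
  obtain ⟨y, hy, rfl⟩ := h₂
  exact ⟨x * y, hx.mul hy, smul_smul _ _ _⟩

theorem SameLine.act {a b : Fin 2 → S} (h : SameLine a b) (g : GL (Fin 2) K) :
    SameLine (act g a) (act g b) := by
  obtain ⟨x, hx, rfl⟩ := h
  exact ⟨x, hx, act_smul _ _ _⟩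

theorem SameLine.evalPair {a b : Fin 2 → S} (h : SameLine a b) {Φ : Pair K} {d : ℕ}
    (hΦ : ∀ i, (Φ i).IsHomogeneous d) : SameLine (evalPair Φ a) (evalPair Φ b) := by
  obtain ⟨x, hx, rfl⟩ := h
  exact ⟨x ^ d, hx.pow d, evalPair_smul hΦ _ _⟩

end Evaluation

/-! ### Projective points and vectors of power series. -/

section Points

variable {L : Type*} [Field L]

/-- Power series over a field form a local ring, so a vector with nonzero reduction has a unit
coordinate, by which one can divide. -/
theorem sameLine_of_wedge_eq_zero {a b : Fin 2 → PowerSeries L}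
    (ha : (fun i => PowerSeries.constantCoeff (a i)) ≠ 0)
    (hb : (fun i => PowerSeries.constantCoeff (b i)) ≠ 0) (h : wedge a b = 0) : SameLine a b := by
  have hunit : ∀ a : Fin 2 → PowerSeries L, (fun i => PowerSeries.constantCoeff (a i)) ≠ 0 →
      ∃ i, IsUnit (a i) := by
    intro a ha
    obtain ⟨i, hi⟩ := Function.ne_iff.mp ha
    exact ⟨i, PowerSeries.isUnit_iff_constantCoeff.mpr (IsUnit.mk0 _ hi)⟩
  rw [wedge, sub_eq_zero] at h
  obtain ⟨i, u, hu⟩ := hunit b hb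
  have key : a = (a i * ↑u⁻¹) • b := by
    have hinv : (b i) * ↑u⁻¹ = 1 := by rw [← hu, Units.mul_inv]
    funext k
    simp only [Pi.smul_apply, smul_eq_mul]
    fin_cases i <;> fin_cases k <;> simp only [Fin.zero_eta, Fin.mk_one] at hinv ⊢
    · linear_combination (-a 0) * hinv
    · linear_combination (-a 1) * hinv - (↑u⁻¹ : PowerSeries L) * h
    · linear_combination (-a 0) * hinv + (↑u⁻¹ : PowerSeries L) * h
    · linear_combination (-a 1) * hinv
  obtain ⟨k, hk⟩ := hunit a ha
  rw [key] at hk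
  exact ⟨_, isUnit_of_mul_isUnit_left hk, key⟩

theorem mk_eq_mk_iff_wedge {a b : Fin 2 → L} (ha : a ≠ 0) (hb : b ≠ 0) :
    Projectivization.mk L a ha = Projectivization.mk L b hb ↔ wedge a b = 0 := by
  rw [Projectivization.mk_eq_mk_iff']
  constructor
  · rintro ⟨c, rfl⟩
    simp only [wedge, Pi.smul_apply, smul_eq_mul]; ring
  · intro h
    rw [wedge, sub_eq_zero] at h
    by_cases hb0 : b 0 = 0
    · have hb1 : b 1 ≠ 0 := fun h1 => hb (by funext i; fin_cases i <;> assumption)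
      have ha0 : a 0 = 0 := by
        rw [hb0, mul_zero] at h
        exact (mul_eq_zero.mp h).resolve_right hb1
      refine ⟨a 1 / b 1, ?_⟩
      funext i; fin_cases i
      · simp [ha0, hb0]
      · simp [hb1]
    · refine ⟨a 0 / b 0, ?_⟩
      funext i; fin_cases i
      · simp [hb0]
      · simp only [Fin.mk_one, Pi.smul_apply, smul_eq_mul]
        field_simp
        linear_combination h

theorem aeval_linForm_rep (P Q : P1 L) : aeval Q.rep (linForm P) = 0 ↔ Q = P := by
  have h := mk_eq_mk_iff_wedge Q.rep_nonzero P.rep_nonzero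
  rw [Projectivization.mk_rep, Projectivization.mk_rep] at h
  rw [h, show linForm P = lineForm P.rep from rfl, aeval_lineForm]
  simp [wedge, mul_comm]

theorem finite_zeros_form {A : BinPoly L} {n : ℕ} (hA : A.IsHomogeneous n) (h0 : A ≠ 0) :
    {Q : P1 L | aeval Q.rep A = 0}.Finite := by
  induction n generalizing A with
  | zero =>
    obtain ⟨c, rfl⟩ : ∃ c, A = C c :=
      ⟨_, totalDegree_eq_zero_iff_eq_C.mp (Nat.le_zero.mp hA.totalDegree_le)⟩
    have hc : c ≠ 0 := by simpa using h0
    simp [hc]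
  | succ n ih =>
    by_cases h : ∃ P : P1 L, aeval P.rep A = 0
    · obtain ⟨P, hP⟩ := h
      obtain ⟨B, hB, rfl⟩ := exists_form_eq_lineForm_mul P.rep_nonzero hA hP
      refine ((ih hB (right_ne_zero_of_mul h0)).insert P).subset ?_
      intro Q hQ
      rw [Set.mem_ofPred_eq, map_mul, mul_eq_zero] at hQ
      exact hQ.imp (aeval_linForm_rep P Q).mp id
    · push Not at h
      convert Set.finite_empty
      exact Set.eq_empty_iff_forall_notMem.mpr h

end Points

/-! ### Iteration on points, and nonvanishing of the forms φ^k - h^j. -/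

section Dynamics

variable {K : Type*} [Field K] {d : ℕ} (φ : RatMap K d) (g : GL (Fin 2) K)

local notation "L" => AlgebraicClosure K

theorem evalPair_ne_zero {v : Fin 2 → L} (hv : v ≠ 0) : evalPair φ.toPair v ≠ 0 :=
  φ.no_common_zero v hv

theorem evalPair_iter_ne_zero (n : ℕ) {v : Fin 2 → L} (hv : v ≠ 0) :
    evalPair (φ.toPair.iter n) v ≠ 0 := by
  induction n with
  | zero => rwa [evalPair_iter_zero]
  | succ n ih => rw [evalPair_iter_succ]; exact evalPair_ne_zero φ ih

theorem act_ne_zero {F : Type*} [Field F] [Algebra K F] {v : Fin 2 → F} (hv : v ≠ 0) :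
    act g v ≠ 0 := by
  intro h
  apply hv
  rw [← act_one (K := K) v, ← inv_mul_cancel g, act_mul, h]
  funext i
  simp [act_apply]

theorem onPoints_iterate_mk (n : ℕ) {v : Fin 2 → L} (hv : v ≠ 0) :
    φ.onPoints^[n] (Projectivization.mk L v hv) =
      Projectivization.mk L (evalPair (φ.toPair.iter n) v) (evalPair_iter_ne_zero φ n hv) := by
  induction n with
  | zero => simp [evalPair_iter_zero]
  | succ n ih =>
    rw [Function.iterate_succ_apply', ih, φ.onPoints_mk]
    congr 1
    exact (evalPair_iter_succ _ _ _).symm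

theorem autOnPoints_mk {v : Fin 2 → L} (hv : v ≠ 0) :
    autOnPoints g (Projectivization.mk L v hv) = Projectivization.mk L (act g v) (act_ne_zero g hv) :=
  rfl

theorem autOnPoints_iterate_mk (j : ℕ) {v : Fin 2 → L} (hv : v ≠ 0) :
    (autOnPoints g)^[j] (Projectivization.mk L v hv) =
      Projectivization.mk L (act (g ^ j) v) (act_ne_zero _ hv) := by
  induction j with
  | zero => simp [act_one]
  | succ j ih =>
    rw [Function.iterate_succ_apply', ih, autOnPoints_mk]
    congr 1
    rw [pow_succ', act_mul]

/-- If the cross form vanished, Φ would be the linear pair times a form A of degree D - 1 ≥ 1, up to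
a constant, and a zero of A would be a common zero of Φ. -/
theorem cross_ofGL_ne_zero {Φ : Pair K} {D : ℕ} (hD : 2 ≤ D) (hΦ : ∀ i, (Φ i).IsHomogeneous D)
    (hzero : ∀ v : Fin 2 → L, v ≠ 0 → evalPair Φ v ≠ 0) : Pair.cross Φ (Pair.ofGL g) ≠ 0 := by
  intro h
  obtain ⟨D, rfl⟩ : ∃ D', D = D' + 1 + 1 := ⟨D - 2, by omega⟩
  set l0 := extend (Pair.ofGL g 0)
  set l1 := extend (Pair.ofGL g 1)
  have hl0 : l0.IsHomogeneous (0 + 1) := (ofGL_isHomogeneous g 0).map _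
  have heq : extend (Φ 0) * l1 = extend (Φ 1) * l0 := by
    have h1 := congrArg (extend (K := K)) h
    simpa [Pair.cross, extend, sub_eq_zero] using h1
  set e : Fin 2 → L := ![0, 1] with he
  have he0 : e ≠ 0 := fun h => one_ne_zero (congrFun h 1)
  -- At this vector `l0` vanishes and `l1` does not, so the vanishing is forced on `Φ 0`.
  set v := act g⁻¹ e with hv
  have hv0 : v ≠ 0 := act_ne_zero _ he0
  have hgv : act g v = e := by rw [hv, ← act_mul, mul_inv_cancel, act_one]
  have hl : ∀ (u : Fin 2 → L) i, aeval u (extend (Pair.ofGL g i)) = act g u i := by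
    intro u i
    rw [aeval_extend, ← evalPair_ofGL]
    rfl
  have h0v : aeval v l0 = 0 := by rw [hl, hgv]; rfl
  have h1v : aeval v l1 = 1 := by rw [hl, hgv]; rfl
  have hA : (extend (Φ 0)).IsHomogeneous (D + 1 + 1) := (hΦ 0).map _
  have hAv : aeval v (extend (Φ 0)) = 0 := by
    have h1 := congrArg (aeval v) heq
    rwa [map_mul, map_mul, h0v, h1v, mul_one, mul_zero] at h1
  obtain ⟨A, hA', hA1⟩ := exists_form_eq_lineForm_mul hv0 hA hAv
  obtain ⟨E, hE, hE1⟩ := exists_form_eq_lineForm_mul hv0 hl0 h0v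
  obtain ⟨c, rfl⟩ : ∃ c, E = C c :=
    ⟨_, totalDegree_eq_zero_iff_eq_C.mp (Nat.le_zero.mp hE.totalDegree_le)⟩
  have hc : c ≠ 0 := by
    rintro rfl
    have h2 : act g (act g⁻¹ ![1, 0] : Fin 2 → L) 0 = 0 := by
      rw [← hl]
      exact (congrArg (aeval _) hE1).trans (by simp)
    rw [← act_mul, mul_inv_cancel, act_one] at h2
    simp at h2
  have hcancel : A * l1 = extend (Φ 1) * C c := by
    apply mul_left_cancel₀ (prime_lineForm hv0).ne_zero
    rw [← mul_assoc, ← hA1, heq, hE1]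
    ring
  obtain ⟨u, hu, hAu⟩ := exists_zero_form D.succ_ne_zero hA'
  apply hzero u hu
  have h0 : aeval u (Φ 0) = 0 := by
    rw [← aeval_extend, hA1, map_mul, hAu, mul_zero]
  have h1 : aeval u (Φ 1) = 0 := by
    have h2 := congrArg (aeval u) hcancel
    rw [map_mul, map_mul, hAu, zero_mul, aeval_C, aeval_extend] at h2
    exact (mul_eq_zero.mp h2.symm).resolve_right hc
  funext i; fin_cases i
  exacts [h0, h1]

end Dynamics

end HTuned

namespace HTuned

/-! ### Iterates of a germ and their contact with the identity. -/

section PowerSeriesEndomorphism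

open PowerSeries

variable {L : Type*} [Field L]

/-- Germs are handled as substitution endomorphisms, so that iterating a germ is taking powers in a
monoid. The case of zero linear coefficient is included. -/
theorem exists_algHom_X_eq {s : PowerSeries L} (hs : constantCoeff s = 0) :
    ∃ E : PowerSeries L →ₐ[L] PowerSeries L, E X = s :=
  ⟨substAlgHom (HasSubst.of_constantCoeff_zero' hs), substAlgHom_X _⟩

variable {E : PowerSeries L →ₐ[L] PowerSeries L}

theorem algHom_C (c : L) : E (C c) = C c := by
  rw [← algebraMap_eq]
  exact E.commutes c

theorem constantCoeff_algHom (hE : constantCoeff (E X) = 0) (f : PowerSeries L) :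
    constantCoeff (E f) = constantCoeff f := by
  obtain ⟨h, hh⟩ := X_dvd_iff.mpr (show constantCoeff (f - C (constantCoeff f)) = 0 by simp)
  rw [sub_eq_iff_eq_add] at hh
  conv_lhs => rw [hh, map_add, map_mul, algHom_C]
  simp [hE]

theorem coeff_one_algHom (hE : constantCoeff (E X) = 0) (f : PowerSeries L) :
    coeff 1 (E f) = coeff 1 (E X) * coeff 1 f := by
  obtain ⟨h, hh⟩ := X_dvd_iff.mpr (show constantCoeff (f - C (constantCoeff f)) = 0 by simp)
  rw [sub_eq_iff_eq_add] at hh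
  have key : ∀ a b : PowerSeries L, constantCoeff a = 0 →
      coeff 1 (a * b) = coeff 1 a * constantCoeff b := by
    intro a b ha
    obtain ⟨a, rfl⟩ := X_dvd_iff.mpr ha
    rw [mul_assoc, show (1 : ℕ) = 0 + 1 from rfl, coeff_succ_X_mul, coeff_succ_X_mul]
    simp
  rw [hh, map_add, map_mul, algHom_C, map_add, map_add, key _ _ hE, key _ _ constantCoeff_X,
    constantCoeff_algHom hE]
  simp

theorem constantCoeff_pow_algHom_X (hE : constantCoeff (E X) = 0) (n : ℕ) :
    constantCoeff ((E ^ n) X) = 0 := by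
  induction n with
  | zero => simp
  | succ n ih => rw [pow_succ', AlgHom.mul_apply, constantCoeff_algHom hE, ih]

theorem coeff_one_pow_algHom_X (hE : constantCoeff (E X) = 0) (n : ℕ) :
    coeff 1 ((E ^ n) X) = coeff 1 (E X) ^ n := by
  induction n with
  | zero => simp
  | succ n ih => rw [pow_succ', AlgHom.mul_apply, coeff_one_algHom hE, ih, pow_succ']

/-- An endomorphism tangent to the identity to order `e ≥ 2` moves `X ^ e f` to order `e + 1`. -/
theorem X_pow_succ_dvd_algHom_sub {e : ℕ} (he : 2 ≤ e) (hE : X ^ e ∣ E X - X) {f : PowerSeries L}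
    (hf : X ^ e ∣ f) : X ^ (e + 1) ∣ E f - f := by
  obtain ⟨s, hs⟩ := hE
  obtain ⟨e, rfl⟩ : ∃ k, e = k + 1 + 1 := ⟨e - 2, by omega⟩
  have hX : E X = X * (1 + X ^ (e + 1) * s) := by linear_combination hs
  obtain ⟨h, rfl⟩ := hf
  rw [map_mul, map_pow, hX, mul_pow, mul_assoc, ← mul_sub, pow_succ X (e + 1 + 1)]
  refine mul_dvd_mul_left _ (X_dvd_iff.mpr ?_)
  have h0 : constantCoeff (E h) = constantCoeff h := constantCoeff_algHom (by simp [hX]) h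
  simp [h0]

/-- Leading deviations from the identity add up: E^{n+1}(X) - X is E(E^n(X) - X) plus E(X) - X, and
E does not change the first summand modulo X^{e+1}. Whether n vanishes in L then decides between
equal and larger contact. -/
theorem X_pow_succ_dvd_pow_algHom_sub {e : ℕ} (he : 2 ≤ e) (hE : X ^ e ∣ E X - X) (n : ℕ) :
    X ^ (e + 1) ∣ ((E ^ n) X - X) - C (n : L) * (E X - X) := by
  induction n with
  | zero => simp
  | succ n ih =>
    have hdvd : X ^ e ∣ (E ^ n) X - X := by
      have h1 := (pow_dvd_pow X e.le_succ).trans ih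
      exact (dvd_sub_left (hE.mul_left _)).mp h1
    have h2 := X_pow_succ_dvd_algHom_sub he hE hdvd
    have h3 := dvd_add ih h2
    convert h3 using 1
    rw [pow_succ', AlgHom.mul_apply, map_sub, Nat.cast_succ, map_add, map_one]
    ring

theorem two_le_order_algHom_sub (h0 : constantCoeff (E X) = 0) (h1 : coeff 1 (E X) = 1) :
    2 ≤ (E X - X).order := by
  refine nat_le_order _ 2 fun i hi => ?_
  interval_cases i
  · simpa using h0
  · simp [h1]

theorem order_pow_algHom_of_ne_zero (h0 : constantCoeff (E X) = 0) (h1 : coeff 1 (E X) = 1)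
    (hne : E X ≠ X) {n : ℕ} (hn : (n : L) ≠ 0) :
    ((E ^ n) X - X).order = (E X - X).order := by
  have hne' := sub_ne_zero.mpr hne
  have he := coe_toNat_order hne'
  have h2 := two_le_order_algHom_sub h0 h1
  have hdvd : X ^ (E X - X).order.toNat ∣ E X - X := X_pow_order_dvd
  have hc := coeff_order hne'
  generalize (E X - X).order.toNat = e at he hdvd hc
  rw [← he] at h2 ⊢
  have h3 := X_pow_succ_dvd_pow_algHom_sub (by exact_mod_cast h2) hdvd n
  rw [X_pow_dvd_iff] at h3 hdvd
  have h4 : ∀ i < e + 1, coeff i ((E ^ n) X - X) = (n : L) * coeff i (E X - X) := by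
    intro i hi
    have h5 := h3 i hi
    rwa [map_sub, coeff_C_mul, sub_eq_zero] at h5
  rw [order_eq_nat]
  refine ⟨?_, fun i hi => ?_⟩
  · rw [h4 e e.lt_succ_self]
    exact mul_ne_zero hn hc
  · rw [h4 i (by omega), hdvd i hi, mul_zero]

theorem order_lt_order_pow_algHom (h0 : constantCoeff (E X) = 0) (h1 : coeff 1 (E X) = 1)
    (hne : E X ≠ X) {n : ℕ} (hn : (n : L) = 0) :
    (E X - X).order < ((E ^ n) X - X).order := by
  have hne' := sub_ne_zero.mpr hne
  have he := coe_toNat_order hne'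
  have h2 := two_le_order_algHom_sub h0 h1
  have hdvd : X ^ (E X - X).order.toNat ∣ E X - X := X_pow_order_dvd
  generalize (E X - X).order.toNat = e at he hdvd
  rw [← he] at h2 ⊢
  have h3 := X_pow_succ_dvd_pow_algHom_sub (by exact_mod_cast h2) hdvd n
  rw [hn, map_zero, zero_mul, sub_zero, X_pow_dvd_iff] at h3
  refine lt_of_lt_of_le ?_ (nat_le_order _ (e + 1) h3)
  exact_mod_cast e.lt_succ_self

/-- The order of contact of the `n`-th iterate with the identity. -/
noncomputable def contact (E : PowerSeries L →ₐ[L] PowerSeries L) (n : ℕ) : ℕ :=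
  ((E ^ n) X - X).order.toNat

/-- The hypothesis excludes infinite order, where `contact` takes the default value 0. -/
theorem coe_contact {n : ℕ} (hne : (E ^ n) X ≠ X) :
    (contact E n : ℕ∞) = ((E ^ n) X - X).order :=
  coe_toNat_order (sub_ne_zero.mpr hne)

/-- The linear coefficient of E^n(X) - X is λ^n - 1. If λ is not a root of unity, `orderOf` is 0,
which divides no n ≥ 1, so every positive n is covered. -/
theorem contact_eq_one (h0 : constantCoeff (E X) = 0) {n : ℕ}
    (hn : ¬ orderOf (coeff 1 (E X)) ∣ n) : contact E n = 1 := by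
  rw [orderOf_dvd_iff_pow_eq_one, ← coeff_one_pow_algHom_X h0] at hn
  have h : ((E ^ n) X - X).order = ((1 : ℕ) : ℕ∞) := by
    rw [order_eq_nat]
    refine ⟨?_, fun i hi => ?_⟩
    · simpa [sub_eq_zero] using hn
    · interval_cases i
      simpa using constantCoeff_pow_algHom_X h0 n
  rw [contact, h, ENat.toNat_natCast]

theorem two_le_contact (h0 : constantCoeff (E X) = 0) {n : ℕ} (hne : (E ^ n) X ≠ X)
    (hn : orderOf (coeff 1 (E X)) ∣ n) : 2 ≤ contact E n := by
  rw [orderOf_dvd_iff_pow_eq_one, ← coeff_one_pow_algHom_X h0] at hn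
  have h2 := two_le_order_algHom_sub (constantCoeff_pow_algHom_X h0 n) hn
  rw [← coe_contact hne] at h2
  exact_mod_cast h2

theorem contact_mul_of_ne_zero (h0 : constantCoeff (E X) = 0) {n k : ℕ} (hne : (E ^ n) X ≠ X)
    (hn : orderOf (coeff 1 (E X)) ∣ n) (hk : (k : L) ≠ 0) : contact E (n * k) = contact E n := by
  rw [orderOf_dvd_iff_pow_eq_one, ← coeff_one_pow_algHom_X h0] at hn
  have h := order_pow_algHom_of_ne_zero (constantCoeff_pow_algHom_X h0 n) hn hne hk
  rw [contact, contact, pow_mul, h]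

theorem contact_lt_contact_mul (h0 : constantCoeff (E X) = 0) {n k : ℕ} (hne : (E ^ n) X ≠ X)
    (hne' : (E ^ (n * k)) X ≠ X) (hn : orderOf (coeff 1 (E X)) ∣ n) (hk : (k : L) = 0) :
    contact E n < contact E (n * k) := by
  rw [orderOf_dvd_iff_pow_eq_one, ← coeff_one_pow_algHom_X h0] at hn
  have h := order_lt_order_pow_algHom (constantCoeff_pow_algHom_X h0 n) hn hne hk
  rw [← pow_mul, ← coe_contact hne, ← coe_contact hne'] at h
  exact_mod_cast h

end PowerSeriesEndomorphism

/-! ### Möbius inversion of contact orders. -/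

section Moebius

open ArithmeticFunction

/-- The Möbius inverse of a function that is `1` off the multiples of `r` and that depends on the
multiples of `r` only through powers of `q`, and strictly increases along these. -/
theorem moebius_sum_nonneg_and_pos_iff {a : ℕ → ℕ} {q r : ℕ} (hq : q = 0 ∨ q.Prime)
    (h1 : ∀ n, 1 ≤ n → ¬ r ∣ n → a n = 1) (h2 : 1 ≤ r → 2 ≤ a r)
    (h3 : ∀ n k, 1 ≤ n → 1 ≤ k → r ∣ n → ¬ q ∣ k → a (n * k) = a n)
    (h4 : q ≠ 0 → ∀ n, 1 ≤ n → r ∣ n → a n < a (n * q)) {n : ℕ} (hn : 1 ≤ n) :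
    0 ≤ ∑ t ∈ n.divisors, moebius (n / t) * (a t : ℤ) ∧
      (1 ≤ ∑ t ∈ n.divisors, moebius (n / t) * (a t : ℤ) ↔
        n = 1 ∨ n = r ∨ ∃ s, 1 ≤ s ∧ n = r * q ^ s) := by
  classical
  -- The Möbius inverse, read off from the jumps of `a` along 1, r, rq, rq², and so on. For r = 1
  -- the first two terms add up to `a 1`; for r = 0 only the first is seen by divisors of a positive
  -- number.
  set D : ℕ → ℤ := fun v => (if v = 1 then 1 else 0) + (if v = r then (a r : ℤ) - 1 else 0) +
    (if q ≠ 0 ∧ ∃ s, 1 ≤ s ∧ v = r * q ^ s then (a v : ℤ) - a (v / q) else 0) with hD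
  have hsum : ∀ n > 0, ∑ v ∈ n.divisors, D v = (a n : ℤ) := by
    intro n hn
    simp only [hD, Finset.sum_add_distrib]
    rw [Finset.sum_ite_eq', if_pos (Nat.one_mem_divisors.mpr hn.ne'), Finset.sum_ite_eq']
    by_cases hr : r ∣ n
    · rw [if_pos (Nat.mem_divisors.mpr ⟨hr, hn.ne'⟩)]
      have hr0 : 0 < r := Nat.pos_of_dvd_of_pos hr hn
      rcases hq with rfl | hq
      · obtain ⟨k, rfl⟩ := hr
        have hk : 0 < k := Nat.pos_of_mul_pos_left hn
        rw [h3 r k hr0 hk dvd_rfl (by simpa using hk.ne')]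
        simp
      · obtain ⟨k, rfl⟩ := hr
        have hk : k ≠ 0 := (Nat.pos_of_mul_pos_left hn).ne'
        -- The factor l prime to q does not affect `a`, and the jumps at r q^s for 1 ≤ s ≤ S
        -- telescope to a(r q^S) - a(r).
        obtain ⟨S, l, hl, rfl⟩ := Nat.exists_eq_pow_mul_and_not_dvd hk q hq.ne_one
        have hl0 : 1 ≤ l := Nat.one_le_iff_ne_zero.mpr (right_ne_zero_of_mul hk)
        rw [← mul_assoc, h3 (r * q ^ S) l (Nat.mul_pos hr0 (Nat.pow_pos hq.pos)) hl0
          (dvd_mul_right _ _) hl, ← Finset.sum_filter]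
        have himg : ((r * q ^ S * l).divisors.filter
            fun v => q ≠ 0 ∧ ∃ s, 1 ≤ s ∧ v = r * q ^ s) =
            (Finset.range S).image fun s => r * q ^ (s + 1) := by
          ext v
          simp only [Finset.mem_filter, Nat.mem_divisors, Finset.mem_image, Finset.mem_range]
          constructor
          · rintro ⟨⟨hdvd, -⟩, -, s, hs, rfl⟩
            refine ⟨s - 1, ?_, by rw [Nat.sub_add_cancel hs]⟩
            rw [mul_assoc] at hdvd
            have h5 := Nat.dvd_of_mul_dvd_mul_left hr0 hdvd
            have h6 : q ^ s ∣ q ^ S :=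
              (Nat.Coprime.pow_left s ((hq.coprime_iff_not_dvd).mpr hl)).dvd_of_dvd_mul_right h5
            have := (Nat.pow_dvd_pow_iff_le_right hq.one_lt).mp h6
            omega
          · rintro ⟨s, hs, rfl⟩
            refine ⟨⟨?_, by rw [mul_assoc]; exact mul_ne_zero hr0.ne' hk⟩, hq.ne_zero, s + 1,
              by omega, rfl⟩
            exact (mul_dvd_mul_left _ (pow_dvd_pow _ hs)).mul_right _
        rw [himg, Finset.sum_image]
        · have h7 : ∀ s, ((a (r * q ^ (s + 1)) : ℤ) - a (r * q ^ (s + 1) / q)) =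
              (a (r * q ^ (s + 1)) : ℤ) - a (r * q ^ s) := by
            intro s
            rw [pow_succ, ← mul_assoc, Nat.mul_div_cancel _ hq.pos]
          simp only [h7]
          rw [Finset.sum_range_sub fun s => (a (r * q ^ s) : ℤ)]
          simp
        · intro s _ t _ hst
          have h8 := Nat.eq_of_mul_eq_mul_left hr0 hst
          have := Nat.pow_right_injective hq.two_le h8
          omega
    · rw [if_neg (mt (fun h => (Nat.mem_divisors.mp h).1) hr), h1 n hn hr]
      rw [Finset.sum_eq_zero]
      · simp
      · intro v hv
        refine if_neg ?_
        rintro ⟨-, s, -, rfl⟩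
        exact hr ((dvd_mul_right _ _).trans (Nat.mem_divisors.mp hv).1)
  have hinv := sum_eq_iff_sum_mul_moebius_eq.mp hsum n hn
  simp only [Int.cast_id] at hinv
  rw [Nat.sum_divisorsAntidiagonal' (f := fun x y => moebius x * (a y : ℤ))] at hinv
  rw [hinv]
  have e1 : (0 : ℤ) ≤ if n = 1 then 1 else 0 := by split_ifs <;> simp
  have e2 : (0 : ℤ) ≤ (if n = r then (a r : ℤ) - 1 else 0) ∧
      (n = r → (1 : ℤ) ≤ if n = r then (a r : ℤ) - 1 else 0) := by
    by_cases h : n = r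
    · have := h2 (h ▸ hn)
      simp only [h, if_true]
      omega
    · simp [h]
  have e3 : (0 : ℤ) ≤ (if q ≠ 0 ∧ ∃ s, 1 ≤ s ∧ n = r * q ^ s then (a n : ℤ) - a (n / q) else 0) ∧
      ((q ≠ 0 ∧ ∃ s, 1 ≤ s ∧ n = r * q ^ s) → (1 : ℤ) ≤
        if q ≠ 0 ∧ ∃ s, 1 ≤ s ∧ n = r * q ^ s then (a n : ℤ) - a (n / q) else 0) := by
    by_cases h : q ≠ 0 ∧ ∃ s, 1 ≤ s ∧ n = r * q ^ s
    · rw [if_pos h]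
      obtain ⟨hq0, s, hs, rfl⟩ := h
      obtain ⟨s, rfl⟩ : ∃ t, s = t + 1 := ⟨s - 1, by omega⟩
      rw [pow_succ, ← mul_assoc, Nat.mul_div_cancel _ (Nat.pos_of_ne_zero hq0)]
      rw [pow_succ, ← mul_assoc] at hn
      have := h4 hq0 (r * q ^ s) (Nat.pos_of_mul_pos_right hn) (dvd_mul_right _ _)
      omega
    · simp [h]
  refine ⟨by simp only [hD]; omega, ?_⟩
  constructor
  · intro h
    by_contra! hcon
    obtain ⟨c1, c2, c3⟩ := hcon
    simp only [hD] at h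
    rw [if_neg c1, if_neg c2, if_neg (by rintro ⟨-, s, hs, h⟩; exact c3 s hs h)] at h
    simp at h
  · rintro (h | h | ⟨s, hs, h⟩)
    · simp only [hD]
      rw [if_pos h]
      omega
    · have := e2.2 h
      simp only [hD]
      omega
    · have hq0 : q ≠ 0 := by
        rintro rfl
        rw [zero_pow (by omega), mul_zero] at h
        omega
      have := e3.2 ⟨hq0, s, hs, h⟩
      simp only [hD]
      omega

end Moebius

section Contact

open PowerSeries ArithmeticFunction

theorem moebius_sum_contact {L : Type*} [Field L] (q : ℕ) [CharP L q]
    {E : PowerSeries L →ₐ[L] PowerSeries L} (h0 : constantCoeff (E X) = 0)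
    (hne : ∀ n, 1 ≤ n → (E ^ n) X ≠ X) {n : ℕ} (hn : 1 ≤ n) :
    0 ≤ ∑ t ∈ n.divisors, moebius (n / t) * (contact E t : ℤ) ∧
      (1 ≤ ∑ t ∈ n.divisors, moebius (n / t) * (contact E t : ℤ) ↔
        n = 1 ∨ n = orderOf (coeff 1 (E X)) ∨
          ∃ s, 1 ≤ s ∧ n = orderOf (coeff 1 (E X)) * q ^ s) := by
  refine moebius_sum_nonneg_and_pos_iff (CharP.char_is_prime_or_zero L q).symm
    (fun n _ h => contact_eq_one h0 h) (fun h => two_le_contact h0 (hne _ h) dvd_rfl)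
    (fun n k hn _ hr hk => contact_mul_of_ne_zero h0 (hne n hn) hr
      (mt (CharP.cast_eq_zero_iff L q k).mp hk))
    (fun hq n hn hr => contact_lt_contact_mul h0 (hne n hn)
      (hne _ (Nat.mul_pos hn (Nat.pos_of_ne_zero hq))) hr (CharP.cast_eq_zero L q)) hn

end Contact

end HTuned

/-! ### Lines through a point over the power series ring. -/

namespace HTuned

open MvPolynomial

theorem SameLine.map {K S S' : Type*} [Field K] [CommRing S] [CommRing S'] [Algebra K S]
    [Algebra K S'] (f : S →ₐ[K] S') {a b : Fin 2 → S} (h : SameLine a b) :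
    SameLine (fun i => f (a i)) fun i => f (b i) := by
  obtain ⟨c, hc, rfl⟩ := h
  exact ⟨f c, hc.map f, by funext i; simp⟩

section Line

variable {L : Type*} [Field L]

/-- Reduction of a vector of power series modulo the variable. -/
noncomputable def redVec (u : Fin 2 → PowerSeries L) : Fin 2 → L :=
  fun i => PowerSeries.constantCoeff (u i)

/-- The vector `v + s w` over the ring of power series. -/
noncomputable def line (v w : Fin 2 → L) (s : PowerSeries L) : Fin 2 → PowerSeries L :=
  fun i => PowerSeries.C (v i) + PowerSeries.C (w i) * s

theorem redVec_line (v w : Fin 2 → L) {s : PowerSeries L} (hs : PowerSeries.constantCoeff s = 0) :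
    redVec (line v w s) = v := by
  funext i; simp [redVec, line, hs]

theorem map_line (E : PowerSeries L →ₐ[L] PowerSeries L) (v w : Fin 2 → L) (s : PowerSeries L) :
    (fun i => E (line v w s i)) = line v w (E s) := by
  funext i
  simp [line, algHom_C]

theorem wedge_line (v w : Fin 2 → L) (s t : PowerSeries L) :
    wedge (line v w s) (line v w t) = PowerSeries.C (wedge v w) * (t - s) := by
  simp only [wedge, line, map_sub, map_mul]
  ring

/-- Cramer's rule writes u = c v + e w. Since u reduces to a nonzero multiple of v, c is a unit and
e has no constant term, so s = e / c. -/
theorem exists_eq_smul_line {v w : Fin 2 → L} (hvw : wedge v w ≠ 0) {u : Fin 2 → PowerSeries L}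
    (hu0 : redVec u ≠ 0) (hu : wedge v (redVec u) = 0) :
    ∃ s : PowerSeries L, PowerSeries.constantCoeff s = 0 ∧ SameLine u (line v w s) := by
  set D : PowerSeries L := PowerSeries.C (wedge v w)⁻¹ with hD
  have hDm : D * (PowerSeries.C (v 0) * PowerSeries.C (w 1) -
      PowerSeries.C (v 1) * PowerSeries.C (w 0)) = 1 := by
    rw [← map_mul, ← map_mul, ← map_sub, ← map_mul]
    change PowerSeries.C ((wedge v w)⁻¹ * wedge v w) = 1
    rw [inv_mul_cancel₀ hvw, map_one]
  set c : PowerSeries L := D * (u 0 * PowerSeries.C (w 1) - u 1 * PowerSeries.C (w 0)) with hc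
  set e : PowerSeries L := D * (PowerSeries.C (v 0) * u 1 - PowerSeries.C (v 1) * u 0) with he
  have hu' : u = fun i => PowerSeries.C (v i) * c + PowerSeries.C (w i) * e := by
    funext i
    fin_cases i <;> simp only [Fin.zero_eta, Fin.mk_one, hc, he]
    · linear_combination (-u 0) * hDm
    · linear_combination (-u 1) * hDm
  have he0 : PowerSeries.constantCoeff e = 0 := by
    have : PowerSeries.constantCoeff e = (wedge v w)⁻¹ * wedge v (redVec u) := by
      simp [he, hD, wedge, redVec]
    rw [this, hu, mul_zero]
  have hc0 : IsUnit c := by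
    rw [PowerSeries.isUnit_iff_constantCoeff, isUnit_iff_ne_zero]
    intro h
    apply hu0
    rw [hu']
    funext i
    simp [redVec, h, he0]
  obtain ⟨c', hc'⟩ := hc0
  refine ⟨↑c'⁻¹ * e, by simp [he0], c, ⟨c', hc'⟩, ?_⟩
  conv_lhs => rw [hu']
  have hcc : c * ↑c'⁻¹ = 1 := by rw [← hc', Units.mul_inv]
  funext i
  simp only [line, Pi.smul_apply, smul_eq_mul]
  linear_combination (-(PowerSeries.C (w i)) * e) * hcc

end Line

/-! ### The germ of h^{-j} φ^m at a point. -/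

section Local

variable {K : Type*} [Field K] {d : ℕ} {φ : RatMap K d} {g : GL (Fin 2) K}

local notation "L" => AlgebraicClosure K

theorem redVec_evalPair (Φ : Pair K) (u : Fin 2 → PowerSeries L) :
    redVec (evalPair Φ u) = evalPair Φ (redVec u) :=
  map_evalPair (constantCoeffAlgHom K L) Φ u

theorem redVec_act (g : GL (Fin 2) K) (u : Fin 2 → PowerSeries L) :
    redVec (act g u) = act g (redVec u) :=
  map_act (constantCoeffAlgHom K L) g u

theorem redVec_evalPair_iter_ne_zero (n : ℕ) {u : Fin 2 → PowerSeries L} (hu : redVec u ≠ 0) :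
    redVec (evalPair (φ.toPair.iter n) u) ≠ 0 := by
  rw [redVec_evalPair]
  exact evalPair_iter_ne_zero φ n hu

theorem redVec_act_ne_zero (g : GL (Fin 2) K) {u : Fin 2 → PowerSeries L} (hu : redVec u ≠ 0) :
    redVec (act g u) ≠ 0 := by
  rw [redVec_act]
  exact act_ne_zero g hu

theorem IsAut.wedge_eq_zero (haut : IsAut φ g) {S : Type*} [CommRing S] [Algebra K S]
    (u : Fin 2 → S) : wedge (evalPair φ.toPair (act g u)) (act g (evalPair φ.toPair u)) = 0 := by
  rw [← evalPair_ofGL, ← evalPair_ofGL, ← evalPair_comp, ← evalPair_comp, ← aeval_cross, haut,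
    map_zero]

theorem IsAut.sameLine (haut : IsAut φ g) {u : Fin 2 → PowerSeries L} (hu : redVec u ≠ 0) :
    SameLine (evalPair φ.toPair (act g u)) (act g (evalPair φ.toPair u)) := by
  refine sameLine_of_wedge_eq_zero ?_ ?_ (haut.wedge_eq_zero u)
  · change redVec _ ≠ 0
    rw [redVec_evalPair]
    exact evalPair_ne_zero φ (redVec_act_ne_zero g hu)
  · refine redVec_act_ne_zero g ?_
    rw [redVec_evalPair]
    exact evalPair_ne_zero φ hu

theorem IsAut.sameLine_iterate (haut : IsAut φ g) (n j : ℕ) {u : Fin 2 → PowerSeries L}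
    (hu : redVec u ≠ 0) : SameLine (evalPair (φ.toPair.iter n) (act (g ^ j) u))
      (act (g ^ j) (evalPair (φ.toPair.iter n) u)) := by
  have h1 : ∀ j (u : Fin 2 → PowerSeries L), redVec u ≠ 0 →
      SameLine (evalPair φ.toPair (act (g ^ j) u)) (act (g ^ j) (evalPair φ.toPair u)) := by
    intro j u hu
    induction j with
    | zero => simpa [act_one] using SameLine.refl _
    | succ j ih =>
      rw [pow_succ', act_mul, act_mul]
      exact (haut.sameLine (redVec_act_ne_zero _ hu)).trans (ih.act g)
  induction n with
  | zero => simpa [evalPair_iter_zero] using SameLine.refl _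
  | succ n ih =>
    rw [evalPair_iter_succ, evalPair_iter_succ]
    exact (ih.evalPair φ.homogeneous).trans (h1 j _ (redVec_evalPair_iter_ne_zero n hu))

theorem IsAut.commute_onPoints (haut : IsAut φ g) :
    Function.Commute φ.onPoints (autOnPoints g) := by
  intro Q
  induction Q using Projectivization.ind with
  | h v hv =>
    rw [autOnPoints_mk, φ.onPoints_mk, φ.onPoints_mk, autOnPoints_mk]
    exact (mk_eq_mk_iff_wedge _ _).mpr (haut.wedge_eq_zero v)

theorem onPoints_iterate_eq_iff (n j : ℕ) {v : Fin 2 → L} (hv : v ≠ 0) :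
    φ.onPoints^[n] (Projectivization.mk L v hv) = (autOnPoints g)^[j] (Projectivization.mk L v hv) ↔
      wedge (evalPair (φ.toPair.iter n) v) (act (g ^ j) v) = 0 := by
  rw [onPoints_iterate_mk, autOnPoints_iterate_mk, mk_eq_mk_iff_wedge]

/-- If `φ^m(Q) = h^j(Q)`, then there is an endomorphism of the ring of germs at `Q` that describes
`h^{-jn} φ^{mn}` for all `n`. -/
theorem exists_germ (haut : IsAut φ g) {v w : Fin 2 → L} (hv : v ≠ 0) (hvw : wedge v w ≠ 0)
    {m j : ℕ} (h : wedge (evalPair (φ.toPair.iter m) v) (act (g ^ j) v) = 0) :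
    ∃ E : PowerSeries L →ₐ[L] PowerSeries L, PowerSeries.constantCoeff (E PowerSeries.X) = 0 ∧
      ∀ n, SameLine (evalPair (φ.toPair.iter (m * n)) (line v w PowerSeries.X))
        (act (g ^ (j * n)) (line v w ((E ^ n) PowerSeries.X))) := by
  have hred : redVec (line v w PowerSeries.X) = v := redVec_line v w PowerSeries.constantCoeff_X
  -- The series s is the coordinate of h^{-j} φ^m(v + Xw) on the line through v in direction w.
  obtain ⟨s, hs, hline⟩ := exists_eq_smul_line hvw
    (u := act (g ^ j)⁻¹ (evalPair (φ.toPair.iter m) (line v w PowerSeries.X)))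
    (redVec_act_ne_zero _ (redVec_evalPair_iter_ne_zero m (hred.symm ▸ hv)))
    (by
      rw [redVec_act, redVec_evalPair, hred]
      have h1 := wedge_act (g ^ j) v (act (g ^ j)⁻¹ (evalPair (φ.toPair.iter m) v))
      rw [← act_mul, mul_inv_cancel, act_one] at h1
      have h2 : wedge (act (g ^ j) v) (evalPair (φ.toPair.iter m) v) = 0 := by
        simp only [wedge] at h ⊢
        linear_combination -h
      rw [h2] at h1
      refine (mul_eq_zero.mp h1.symm).resolve_left ?_
      rw [map_eq_zero_iff _ (algebraMap K L).injective]
      exact ((Matrix.isUnit_iff_isUnit_det _).mp (g ^ j).isUnit).ne_zero)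
  obtain ⟨E, hE⟩ := exists_algHom_X_eq hs
  have hE0 : PowerSeries.constantCoeff (E PowerSeries.X) = 0 := hE ▸ hs
  have h1 : SameLine (evalPair (φ.toPair.iter m) (line v w PowerSeries.X))
      (act (g ^ j) (line v w (E PowerSeries.X))) := by
    have h2 := hline.act (g ^ j)
    rwa [← act_mul, mul_inv_cancel, act_one, ← hE] at h2
  refine ⟨E, hE0, fun n => ?_⟩
  induction n with
  | zero => simpa [evalPair_iter_zero, act_one] using SameLine.refl _
  | succ n ih =>
    have hn0 := constantCoeff_pow_algHom_X hE0 n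
    have h3 : redVec (line v w ((E ^ n) PowerSeries.X)) ≠ 0 := by rwa [redVec_line v w hn0]
    have h4 := ih.evalPair (iter_isHomogeneous φ.homogeneous m)
    rw [← evalPair_iter_add] at h4
    have h5 := haut.sameLine_iterate m (j * n) h3
    -- Substituting E^n(X) for X in the relation that defines E turns it into the step from n to n +
    -- 1.
    have h6 := (h1.map ((E ^ n).restrictScalars K)).act (g ^ (j * n))
    rw [map_evalPair, map_act, ← act_mul, ← pow_add] at h6
    simp only [AlgHom.restrictScalars_apply] at h6
    rw [map_line, map_line, ← AlgHom.mul_apply, ← pow_succ] at h6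
    rw [mul_add, mul_add, mul_one, mul_one, add_comm (m * n) m]
    exact (h4.trans h5).trans h6

/-- The order of `φ^{mn} - h^{jn}` at `Q` is the order of contact of the germ with the identity. -/
theorem order_cross_eq {v w : Fin 2 → L} (hvw : wedge v w ≠ 0) {k i : ℕ} {s : PowerSeries L}
    (h : SameLine (evalPair (φ.toPair.iter k) (line v w PowerSeries.X)) (act (g ^ i) (line v w s))) :
    (aeval (line v w PowerSeries.X) (Pair.cross (φ.toPair.iter k) (Pair.ofGL (g ^ i)))).order =
      (s - PowerSeries.X).order := by
  obtain ⟨c, hc, h⟩ := h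
  rw [aeval_cross, evalPair_ofGL, h, wedge_smul_left, wedge_act, wedge_line, PowerSeries.order_mul,
    PowerSeries.order_mul, PowerSeries.order_mul, PowerSeries.order_zero_of_unit hc,
    PowerSeries.order_zero_of_unit ((IsUnit.mk0 _ hvw).map _), PowerSeries.order_zero_of_unit
      (((Matrix.isUnit_iff_isUnit_det _).mp (g ^ i).isUnit).map (algebraMap K (PowerSeries L))),
    zero_add, zero_add, zero_add, ← PowerSeries.order_neg, neg_sub]

end Local

end HTuned

namespace HTuned

open MvPolynomial

/-! ### Times at which an orbit of one map meets an orbit of a commuting map. -/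

section CommutingMaps

theorem iterate_mul_eq {α : Type*} {F G : α → α} (hFG : Function.Commute F G) {Q : α} {m j : ℕ}
    (h : F^[m] Q = G^[j] Q) (n : ℕ) : F^[m * n] Q = G^[j * n] Q := by
  induction n with
  | zero => rfl
  | succ n ih =>
    rw [mul_add, mul_one, add_comm, Function.iterate_add_apply, ih,
      (hFG.iterate_iterate m (j * n)).eq, h, ← Function.iterate_add_apply, mul_add, mul_one]

theorem iterate_eq_iterate_iff_mod {α : Type*} {G : α → α} {p : ℕ} (hp : p.Prime) {Q : α}
    (hper : G^[p] Q = Q) (hQ : G Q ≠ Q) (a b : ℕ) : G^[a] Q = G^[b] Q ↔ a % p = b % p := by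
  have := Fact.mk hp
  have hmin : Function.minimalPeriod G Q = p := Function.minimalPeriod_eq_prime hper hQ
  rw [← Function.iterate_mod_minimalPeriod_eq (n := a), ← Function.iterate_mod_minimalPeriod_eq (n := b),
    hmin]
  refine ⟨fun h => ?_, fun h => by rw [h]⟩
  refine Function.iterate_injOn_Iio_minimalPeriod (f := G) (x := Q) ?_ ?_ h <;>
    rw [hmin] <;> exact Nat.mod_lt _ hp.pos

/-- The times at which the `F`-orbit of `Q` meets the punctured `G`-orbit of `Q` are the multiples
`m n` of the first one with `n` prime to the order `p` of `G`. -/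
theorem exists_iterate_eq_iff {α : Type*} {F G : α → α} (hFG : Function.Commute F G) {p : ℕ}
    (hp : p.Prime) {Q : α} (hper : G^[p] Q = Q) (hQ : G Q ≠ Q) {m : ℕ}
    (hm : IsLeast {N : ℕ | 0 < N ∧ ∃ j, 0 < j ∧ ¬ p ∣ j ∧ F^[N] Q = G^[j] Q} m) {k : ℕ}
    (hk : 0 < k) :
    (∃ j, 0 < j ∧ ¬ p ∣ j ∧ F^[k] Q = G^[j] Q) ↔ ∃ n, k = m * n ∧ ¬ p ∣ n := by
  obtain ⟨⟨hm0, j, hj0, hpj, hj⟩, hmin⟩ := hm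
  have hmul := iterate_mul_eq hFG hj
  constructor
  · rintro ⟨i, hi0, hpi, hi⟩
    set n := k / m
    set s := k % m
    have hks : s + m * n = k := Nat.mod_add_div k m
    -- G^{-jn} is written as G^{jn(p-1)}, since G^p fixes Q; this isolates the remainder s of k
    -- modulo m.
    have hs : F^[s] Q = G^[i + j * n * (p - 1)] Q := by
      rw [← hks, Function.iterate_add_apply, hmul, (hFG.iterate_iterate s (j * n)).eq] at hi
      have h1 := congrArg G^[j * n * (p - 1)] hi
      rw [← Function.iterate_add_apply, ← Function.iterate_add_apply, ← Nat.mul_succ, Nat.succ_eq_add_one,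
        Nat.sub_add_cancel hp.one_lt.le, ← (hFG.iterate_iterate s (j * n * p)).eq, add_comm _ i] at h1
      rw [← h1]
      congr 1
      have := (iterate_eq_iterate_iff_mod hp hper hQ 0 (j * n * p)).mpr (by simp)
      exact this
    rcases Nat.eq_zero_or_pos s with h0 | h0
    · refine ⟨n, by omega, fun hpn => hpi ?_⟩
      rw [h0] at hs
      have h1 := (iterate_eq_iterate_iff_mod hp hper hQ 0 _).mp hs
      rw [Nat.zero_mod] at h1
      have h2 := Nat.dvd_of_mod_eq_zero h1.symm
      exact (Nat.dvd_add_left ((hpn.mul_left j).mul_right _)).mp h2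
    · exfalso
      have hsm : s < m := Nat.mod_lt _ hm0
      -- If p divides the exponent, then F^s fixes Q and m - s is a smaller time than m; otherwise s
      -- itself is one.
      by_cases ht : p ∣ i + j * n * (p - 1)
      · have h1 : F^[s] Q = Q := by
          rw [hs]
          exact (iterate_eq_iterate_iff_mod hp hper hQ _ 0).mpr (by simpa using Nat.mod_eq_zero_of_dvd ht)
        have h2 : F^[m - s] Q = G^[j] Q := by
          rw [← hj]
          conv_rhs => rw [← Nat.sub_add_cancel hsm.le, Function.iterate_add_apply, h1]
        have := hmin (a := m - s) ⟨by omega, j, hj0, hpj, h2⟩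
        omega
      · have := hmin (a := s) ⟨h0, _, by omega, ht, hs⟩
        omega
  · rintro ⟨n, rfl, hn⟩
    have hpn : ¬ p ∣ j * n := fun h => (hp.dvd_mul.mp h).elim hpj hn
    exact ⟨j * n, Nat.pos_of_ne_zero fun h => hpn (h ▸ dvd_zero p), hpn, hmul n⟩

end CommutingMaps

/-! ### Coordinate changes and the ratio of the λ₁. -/

section Multiplier

theorem act_map {K F S : Type*} [Field K] [Field F] [CommRing S] [Algebra K F] [Algebra F S]
    [Algebra K S] [IsScalarTower K F S] (g : GL (Fin 2) K) (u : Fin 2 → S) :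
    act (g.map (algebraMap K F)) u = act g u := by
  funext i
  rw [act_apply, act_apply, IsScalarTower.algebraMap_apply K F S,
    IsScalarTower.algebraMap_apply K F S]
  rfl

theorem smul_mk_eq {F : Type*} [Field F] (f : GL (Fin 2) F) {v : Fin 2 → F} (hv : v ≠ 0) :
    f • Projectivization.mk F v hv = Projectivization.mk F (act f v) (act_ne_zero f hv) := by
  rw [Projectivization.smul_mk]
  congr 1

variable {F : Type*} [Field F]

theorem lam_eq (i : ℕ) (Φ : Pair F) (z : F) :
    Pair.lam i Φ z = PowerSeries.coeff i
      (evalPair Φ (![PowerSeries.C z + PowerSeries.X, 1] : Fin 2 → PowerSeries F) 0 *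
        (evalPair Φ (![PowerSeries.C z + PowerSeries.X, 1] : Fin 2 → PowerSeries F) 1)⁻¹) := by
  have h : ∀ A : BinPoly F, (Polynomial.taylor z (Pair.dehom A) : PowerSeries F) =
      aeval (![PowerSeries.C z + PowerSeries.X, 1] : Fin 2 → PowerSeries F) A := by
    intro A
    have h1 := comp_aeval_apply ![Polynomial.X, 1]
      ((Polynomial.coeToPowerSeries.algHom F).comp (Polynomial.taylorAlgHom z)) A
    have h2 : (fun i => ((Polynomial.coeToPowerSeries.algHom F).comp (Polynomial.taylorAlgHom z))
        ((![Polynomial.X, 1] : Fin 2 → Polynomial F) i)) =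
        (![PowerSeries.C z + PowerSeries.X, 1] : Fin 2 → PowerSeries F) := by
      funext i
      fin_cases i
      · simp [Polynomial.coeToPowerSeries.algHom, add_comm]
      · simp
    rw [h2] at h1
    rw [← h1]
    simp [Pair.dehom, Polynomial.coeToPowerSeries.algHom]
  rw [Pair.lam, h, h]
  rfl

/-- With v = f(z, 1) and w = f(1, 0), the affine coordinate of the chart is the parameter on the
line v + sw, so the germ and the λ₁ use the same variable. -/
theorem act_affine (f : GL (Fin 2) F) (z : F) (s : PowerSeries F) :
    act f (![PowerSeries.C z + s, 1] : Fin 2 → PowerSeries F) =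
      line (act f ![z, 1]) (act f ![1, 0]) s := by
  funext i
  simp only [act_apply, line, PowerSeries.algebraMap_eq, Algebra.algebraMap_self, RingHom.id_apply,
    map_add, map_mul, Matrix.cons_val_zero, Matrix.cons_val_one, map_one, map_zero]
  ring

/-- The multiplier of a germ that is conjugated by a Möbius transformation on the left. -/
theorem coeff_one_moebius_ratio {E : PowerSeries F →ₐ[F] PowerSeries F}
    (hE : PowerSeries.constantCoeff (E PowerSeries.X) = 0) (M : GL (Fin 2) F) {z : F}
    (hz : act M ![z, 1] 1 ≠ 0) {u : Fin 2 → PowerSeries F}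
    (hu : SameLine u (act M ![PowerSeries.C z + E PowerSeries.X, 1])) :
    PowerSeries.coeff 1 (u 0 * (u 1)⁻¹) /
      PowerSeries.coeff 1 (act M (![PowerSeries.C z + PowerSeries.X, 1] : Fin 2 → PowerSeries F) 0 *
        (act M (![PowerSeries.C z + PowerSeries.X, 1] : Fin 2 → PowerSeries F) 1)⁻¹) =
      PowerSeries.coeff 1 (E PowerSeries.X) := by
  set P := act M (![PowerSeries.C z + PowerSeries.X, 1] : Fin 2 → PowerSeries F) with hP
  have hP0 : ∀ i, PowerSeries.constantCoeff (P i) = act M ![z, 1] i := by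
    intro i
    simp [hP, act_apply, PowerSeries.algebraMap_eq]
  have hP1 : ∀ i, PowerSeries.coeff 1 (P i) = M i 0 := by
    intro i
    simp [hP, act_apply, PowerSeries.algebraMap_eq]
  have hPunit : PowerSeries.constantCoeff (P 1) ≠ 0 := by rwa [hP0]
  obtain ⟨c, hc, rfl⟩ := hu
  have hEP : act M ![PowerSeries.C z + E PowerSeries.X, 1] = fun i => E (P i) := by
    rw [hP, map_act]
    congr 1
    funext i
    fin_cases i <;> simp [algHom_C]
  -- The unit c cancels in the quotient, so the numerator series is E applied to the denominator
  -- series.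
  have hnum : (c • act M ![PowerSeries.C z + E PowerSeries.X, 1]) 0 *
      ((c • act M ![PowerSeries.C z + E PowerSeries.X, 1]) 1)⁻¹ = E (P 0 * (P 1)⁻¹) := by
    rw [hEP]
    simp only [Pi.smul_apply, smul_eq_mul]
    symm
    have hc0 : PowerSeries.constantCoeff c ≠ 0 :=
      (PowerSeries.isUnit_iff_constantCoeff.mp hc).ne_zero
    rw [PowerSeries.eq_mul_inv_iff_mul_eq]
    · rw [mul_left_comm, ← map_mul, mul_assoc, PowerSeries.inv_mul_cancel _ hPunit, mul_one]
    · rw [map_mul, constantCoeff_algHom hE]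
      exact mul_ne_zero hc0 hPunit
  rw [hnum, coeff_one_algHom hE, mul_div_assoc, div_self, mul_one]
  -- A Möbius map has nonzero derivative at a finite point with finite image: a vanishing linear
  -- coefficient of S would make the rows of M proportional.
  intro h
  set S := P 0 * (P 1)⁻¹ with hS
  have hSP : S * P 1 = P 0 := by
    rw [hS, mul_assoc, PowerSeries.inv_mul_cancel _ hPunit, mul_one]
  have h0 := congrArg PowerSeries.constantCoeff hSP
  have h1 := congrArg (PowerSeries.coeff 1) hSP
  rw [map_mul, hP0, hP0] at h0
  rw [PowerSeries.coeff_mul, Finset.Nat.antidiagonal_succ] at h1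
  simp only [Finset.sum_cons, Finset.Nat.antidiagonal_zero, Finset.map_singleton,
    Finset.sum_singleton, Function.Embedding.prodMap, Function.Embedding.coeFn_mk, Prod.map_apply,
    Function.Embedding.refl_apply, PowerSeries.coeff_zero_eq_constantCoeff, hP1, h, zero_mul,
    Nat.succ_eq_add_one, zero_add] at h1
  have hdet : M.val.det ≠ 0 := ((Matrix.isUnit_iff_isUnit_det _).mp M.isUnit).ne_zero
  apply hdet
  rw [Matrix.det_fin_two]
  simp only [act_apply, Algebra.algebraMap_self, RingHom.id_apply, Matrix.cons_val_zero,
    Matrix.cons_val_one, mul_one] at h0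
  linear_combination M 1 0 * h0 - (M 1 0 * z + M 1 1) * h1

variable {K : Type*} [Field K] {d : ℕ} {φ : RatMap K d} {g : GL (Fin 2) K}

local notation "L" => AlgebraicClosure K

theorem evalPair_toClosure {S : Type*} [CommRing S] [Algebra L S] [Algebra K S]
    [IsScalarTower K L S] (Φ : Pair K) (u : Fin 2 → S) :
    evalPair Φ.toClosure u = evalPair Φ u := by
  funext i
  exact aeval_extend u (Φ i)

theorem evalPair_conj (f : GL (Fin 2) F) (Φ : Pair F) {S : Type*} [CommRing S] [Algebra F S]
    (u : Fin 2 → S) : evalPair (Pair.conj f Φ) u = act f⁻¹ (evalPair Φ (act f u)) := by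
  rw [Pair.conj, evalPair_comp, evalPair_comp, evalPair_ofGL, evalPair_ofGL]

/-- The ratio of the multipliers of `φ^m` and `h^j` at `Q` is the multiplier of the germ of
`h^{-j} φ^m` at `Q`. -/
theorem lamRatio_eq {f : GL (Fin 2) L} {z : L} {m j : ℕ}
    {E : PowerSeries L →ₐ[L] PowerSeries L} (hE : PowerSeries.constantCoeff (E PowerSeries.X) = 0)
    (hinf : (autOnPoints g)^[j] (f • affinePoint z) ≠ f • infinity)
    (h : SameLine (evalPair (φ.toPair.iter m) (line (act f ![z, 1]) (act f ![1, 0]) PowerSeries.X))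
      (act (g ^ j) (line (act f ![z, 1]) (act f ![1, 0]) (E PowerSeries.X)))) :
    lamRatio φ g m j f z = PowerSeries.coeff 1 (E PowerSeries.X) := by
  set M : GL (Fin 2) L := f⁻¹ * ((g ^ j).map (algebraMap K L)) * f with hM
  have hMact : ∀ s : PowerSeries L, act M ![PowerSeries.C z + s, 1] =
      act f⁻¹ (act (g ^ j) (line (act f ![z, 1]) (act f ![1, 0]) s)) := by
    intro s
    rw [hM, act_mul, act_mul, act_map, act_affine]
  -- The denominator of f^{-1} h^j f vanishes at z only if h^j(Q) = f(∞), which `hinf` excludes.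
  have hz : act M ![z, 1] 1 ≠ 0 := by
    intro hz
    apply hinf
    have hv : (![z, 1] : Fin 2 → L) ≠ 0 := fun h => one_ne_zero (congrFun h 1)
    rw [affinePoint, infinity, smul_mk_eq, smul_mk_eq, autOnPoints_iterate_mk, mk_eq_mk_iff_wedge]
    have h1 := wedge_act f (act M ![z, 1]) (![1, 0] : Fin 2 → L)
    have h2 : act f (act M ![z, 1]) = act (g ^ j) (act f ![z, 1]) := by
      rw [hM, act_mul, act_mul, act_map, ← act_mul f f⁻¹, mul_inv_cancel, act_one]
    rw [← h2, h1]
    simp [wedge, hz]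
  rw [lamRatio, lam_eq, lam_eq, evalPair_conj, evalPair_conj, evalPair_toClosure,
    evalPair_toClosure, act_affine, evalPair_ofGL, ← hMact]
  exact coeff_one_moebius_ratio hE M hz (by rw [hMact]; exact h.act f⁻¹)

end Multiplier

end HTuned

namespace HTuned

open MvPolynomial ArithmeticFunction

/-! ### Orders of Ψ and Ψ* outside Fix(h). -/

section Assembly

variable {K : Type*} [Field K] {d : ℕ} {φ : RatMap K d} {g : GL (Fin 2) K} {p : ℕ}

local notation "L" => AlgebraicClosure K

theorem exists_linForm_mk_eq {F : Type*} [Field F] {v : Fin 2 → F} (hv : v ≠ 0) :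
    ∃ a : F, a ≠ 0 ∧ linForm (Projectivization.mk F v hv) = lineForm (a • v) := by
  obtain ⟨a, ha⟩ := Projectivization.exists_smul_eq_mk_rep F v hv
  exact ⟨a, a.ne_zero, by rw [← Units.smul_def, ha]; rfl⟩

theorem multiplicity_linForm_eq_order {v w : Fin 2 → L} (hv : v ≠ 0) (hvw : wedge v w ≠ 0)
    {A : BinPoly K} {n : ℕ} (hA : A.IsHomogeneous n) (h0 : A ≠ 0) :
    (multiplicity (linForm (Projectivization.mk L v hv)) (extend A) : ℕ∞) =
      (aeval (line v w PowerSeries.X) A).order := by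
  obtain ⟨a, ha, h⟩ := exists_linForm_mk_eq hv
  rw [h, multiplicity_lineForm_smul ha, multiplicity_lineForm_eq_order hv (w := w) ?_ (hA.map _)
    (extend_ne_zero h0)]
  · exact congrArg PowerSeries.order (aeval_extend (line v w PowerSeries.X) A)
  · intro h1
    apply hvw
    simp only [wedge]
    linear_combination -h1

theorem cross_iter_ne_zero (hd : 2 ≤ d) {k : ℕ} (hk : 1 ≤ k) (g : GL (Fin 2) K) :
    Pair.cross (φ.toPair.iter k) (Pair.ofGL g) ≠ 0 :=
  cross_ofGL_ne_zero g (hd.trans (Nat.le_self_pow (by omega) d))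
    (iter_isHomogeneous φ.homogeneous k) fun _ hv => evalPair_iter_ne_zero φ k hv

theorem cross_iter_isHomogeneous (k : ℕ) (g : GL (Fin 2) K) :
    (Pair.cross (φ.toPair.iter k) (Pair.ofGL g)).IsHomogeneous (d ^ k + 1) :=
  cross_isHomogeneous (iter_isHomogeneous φ.homogeneous k) (ofGL_isHomogeneous g)

theorem Psi_isHomogeneous (p k : ℕ) : ∃ n, (Psi φ g p k).IsHomogeneous n :=
  ⟨_, IsHomogeneous.prod _ _ _ fun j _ => cross_iter_isHomogeneous k (g ^ j)⟩

theorem Psi_ne_zero (hd : 2 ≤ d) {k : ℕ} (hk : 1 ≤ k) : Psi φ g p k ≠ 0 :=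
  Finset.prod_ne_zero_iff.mpr fun j _ => cross_iter_ne_zero hd hk (g ^ j)

theorem ordAt_Psi (hd : 2 ≤ d) {k : ℕ} (hk : 1 ≤ k) (Q : P1 L) :
    ordAt Q (algebraMap (BinPoly K) (RatFun K) (Psi φ g p k)) = ∑ j ∈ Finset.Ico 1 p,
      (multiplicity (linForm Q) (extend (Pair.cross (φ.toPair.iter k) (Pair.ofGL (g ^ j)))) : ℤ) := by
  have hinj := IsFractionRing.injective (BinPoly K) (RatFun K)
  rw [Psi, map_prod, ordAt_prod]
  · exact Finset.sum_congr rfl fun j _ => ordAt_algebraMap Q (cross_iter_ne_zero hd hk _)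
  · exact fun j _ => (map_ne_zero_iff _ hinj).mpr (cross_iter_ne_zero hd hk _)

theorem isFormQuotient_Psi (hd : 2 ≤ d) {k : ℕ} (hk : 1 ≤ k) :
    IsFormQuotient (algebraMap (BinPoly K) (RatFun K) (Psi φ g p k)) :=
  have ⟨_, hn⟩ := Psi_isHomogeneous (φ := φ) (g := g) p k
  IsFormQuotient.of_form hn (Psi_ne_zero hd hk)

theorem isFormQuotient_PsiStar (hd : 2 ≤ d) (N : ℕ) : IsFormQuotient (PsiStar φ g p N) :=
  IsFormQuotient.prod _ _ fun _ hk => (isFormQuotient_Psi hd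
    (Nat.pos_of_mem_divisors (Finset.mem_of_mem_filter _ hk))).zpow _

theorem ordAt_PsiStar (hd : 2 ≤ d) (N : ℕ) (Q : P1 L) :
    ordAt Q (PsiStar φ g p N) = ∑ k ∈ N.divisors with ¬ p * k ∣ N,
      moebius (N / k) * ordAt Q (algebraMap (BinPoly K) (RatFun K) (Psi φ g p k)) := by
  have hpos : ∀ k ∈ N.divisors.filter (fun k => ¬ p * k ∣ N), 1 ≤ k := fun k hk =>
    Nat.pos_of_mem_divisors (Finset.mem_of_mem_filter _ hk)
  rw [PsiStar, ordAt_prod]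
  · exact Finset.sum_congr rfl fun k hk =>
      ordAt_zpow Q (isFormQuotient_Psi hd (hpos k hk)).ne_zero _
  · exact fun k hk => zpow_ne_zero _ (isFormQuotient_Psi hd (hpos k hk)).ne_zero

/-- A form does not vanish at `Q` unless `Q` is a point at which the two maps agree. -/
theorem onPoints_eq_of_multiplicity_ne_zero {k j : ℕ} {Q : P1 L}
    (h : multiplicity (linForm Q)
      (extend (Pair.cross (φ.toPair.iter k) (Pair.ofGL (g ^ j)))) ≠ 0) :
    φ.onPoints^[k] Q = (autOnPoints g)^[j] Q := by
  by_contra hne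
  apply h
  refine multiplicity_lineForm_eq_zero Q.rep_nonzero ((cross_iter_isHomogeneous k _).map _) ?_
  rw [aeval_extend, aeval_cross, evalPair_ofGL]
  intro h0
  have h1 := (onPoints_iterate_eq_iff k j Q.rep_nonzero).mpr h0
  rw [Projectivization.mk_rep] at h1
  exact hne h1

theorem ordAt_Psi_eq_zero (hd : 2 ≤ d) {k : ℕ} (hk : 1 ≤ k) {Q : P1 L}
    (h : ¬ HasHPeriod φ g p Q k) :
    ordAt Q (algebraMap (BinPoly K) (RatFun K) (Psi φ g p k)) = 0 := by
  rw [ordAt_Psi hd hk]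
  refine Finset.sum_eq_zero fun j hj => ?_
  rw [Finset.mem_Ico] at hj
  rw [Nat.cast_eq_zero]
  by_contra hne
  exact h ⟨j, hj.1, Nat.not_dvd_of_pos_of_lt hj.1 hj.2, onPoints_eq_of_multiplicity_ne_zero hne⟩

/-- The order is p only in PGL₂, so g^p is a scalar matrix and not necessarily the identity. -/
theorem sameLine_act_pow_mul (hord : orderOf (Matrix.ProjGenLinGroup.mk g) = p) {S : Type*}
    [CommRing S] [Algebra K S] (n : ℕ) (u : Fin 2 → S) : SameLine (act (g ^ (p * n)) u) u := by
  have h1 : SameLine u (act (g ^ p) u) := by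
    have h2 : Matrix.ProjGenLinGroup.mk (g ^ p) = Matrix.ProjGenLinGroup.mk 1 := by
      rw [map_pow, ← hord, pow_orderOf_eq_one, map_one]
    obtain ⟨a, ha⟩ := Matrix.ProjGenLinGroup.mk_eq_mk_iff.mp h2
    refine ⟨algebraMap K S a, a.isUnit.map _, ?_⟩
    have h3 : act (Matrix.GeneralLinearGroup.scalar (Fin 2) a) u = algebraMap K S a • u := by
      funext i
      rw [act_apply]
      fin_cases i <;> simp
    rw [← act_smul, ← h3, ← act_mul, ha, act_one]
  induction n with
  | zero => simpa [act_one] using SameLine.refl u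
  | succ n ih =>
    rw [mul_add, mul_one, pow_add, act_mul]
    exact (h1.symm.act _).trans ih

theorem autOnPoints_iterate_order (hord : orderOf (Matrix.ProjGenLinGroup.mk g) = p) (Q : P1 L) :
    (autOnPoints g)^[p] Q = Q := by
  induction Q using Projectivization.ind with
  | h v hv =>
    rw [autOnPoints_iterate_mk, Projectivization.mk_eq_mk_iff']
    obtain ⟨c, -, hc⟩ := sameLine_act_pow_mul (S := L) hord 1 v
    rw [mul_one] at hc
    exact ⟨c, hc.symm⟩

/-- A germ equal to the identity would give infinite order to a nonzero form; this is where d ≥ 2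
makes all contact orders finite. -/
theorem pow_algHom_X_ne (hd : 2 ≤ d) {v w : Fin 2 → L} (hv : v ≠ 0) (hvw : wedge v w ≠ 0) {k i : ℕ}
    (hk : 1 ≤ k) {s : PowerSeries L}
    (h : SameLine (evalPair (φ.toPair.iter k) (line v w PowerSeries.X))
      (act (g ^ i) (line v w s))) : s ≠ PowerSeries.X := by
  have h1 := multiplicity_linForm_eq_order hv hvw (cross_iter_isHomogeneous (φ := φ) k (g ^ i))
    (cross_iter_ne_zero hd hk _)
  rw [order_cross_eq hvw h] at h1
  rintro rfl
  simp at h1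

/-- The order of `Ψ_{pk}` at `Q` in terms of the germ of `h^{-j} φ^m` at `Q`. -/
theorem ordAt_Psi_eq_contact (hd : 2 ≤ d) (hp : p.Prime)
    (hord : orderOf (Matrix.ProjGenLinGroup.mk g) = p) {v w : Fin 2 → L} (hv : v ≠ 0)
    (hvw : wedge v w ≠ 0) (hQ : Projectivization.mk L v hv ∉ fixSet g) {m j n : ℕ}
    (hmn : 1 ≤ m * n) (hjn : ¬ p ∣ j * n) {E : PowerSeries L →ₐ[L] PowerSeries L}
    (hE : SameLine (evalPair (φ.toPair.iter (m * n)) (line v w PowerSeries.X))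
        (act (g ^ (j * n)) (line v w ((E ^ n) PowerSeries.X))))
    (hmn' : φ.onPoints^[m * n] (Projectivization.mk L v hv) =
      (autOnPoints g)^[j * n] (Projectivization.mk L v hv)) :
    ordAt (Projectivization.mk L v hv)
      (algebraMap (BinPoly K) (RatFun K) (Psi φ g p (m * n))) = contact E n := by
  -- The index of the only factor of Ψ that vanishes at Q; the p points of the h-orbit are distinct,
  -- which rules out the other indices.
  set i := (j * n) % p with hi
  have hip : i < p := Nat.mod_lt _ hp.pos
  have hi1 : 1 ≤ i := Nat.pos_of_ne_zero (mt Nat.dvd_of_mod_eq_zero hjn)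
  have hiE : SameLine (evalPair (φ.toPair.iter (m * n)) (line v w PowerSeries.X))
        (act (g ^ i) (line v w ((E ^ n) PowerSeries.X))) := by
    have h1 := (sameLine_act_pow_mul hord (j * n / p) (line v w ((E ^ n) PowerSeries.X))).act
      (g ^ i)
    rw [← act_mul, ← pow_add, hi, Nat.mod_add_div] at h1
    exact hE.trans h1
  rw [ordAt_Psi hd hmn, Finset.sum_eq_single_of_mem i (Finset.mem_Ico.mpr ⟨hi1, hip⟩)]
  · have h1 := multiplicity_linForm_eq_order hv hvw
      (cross_iter_isHomogeneous (φ := φ) (m * n) (g ^ i)) (cross_iter_ne_zero hd hmn _)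
    rw [order_cross_eq hvw hiE, ← coe_contact (pow_algHom_X_ne hd hv hvw hmn hiE)] at h1
    exact_mod_cast h1
  · intro i' hi' hne
    rw [Finset.mem_Ico] at hi'
    rw [Nat.cast_eq_zero]
    by_contra h0
    have h1 := (onPoints_eq_of_multiplicity_ne_zero h0).symm.trans hmn'
    rw [iterate_eq_iterate_iff_mod hp (autOnPoints_iterate_order hord _) hQ,
      Nat.mod_eq_of_lt hi'.2] at h1
    exact hne h1

/-- The order of `Ψ*_{pN}` at a point that is not fixed by `h`. -/
theorem ordAt_PsiStar_nonneg_and_pos_iff (q : ℕ) [CharP K q] (hd : 2 ≤ d) (hp : p.Prime)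
    (hord : orderOf (Matrix.ProjGenLinGroup.mk g) = p) (haut : IsAut φ g) {N : ℕ} (hN : 1 ≤ N)
    {v w : Fin 2 → L} (hv : v ≠ 0) (hvw : wedge v w ≠ 0)
    (hQ : Projectivization.mk L v hv ∉ fixSet g) {m j : ℕ}
    (hm : IsPrimitiveHPeriod φ g p (Projectivization.mk L v hv) m) (hj : ¬ p ∣ j)
    (hmj : φ.onPoints^[m] (Projectivization.mk L v hv) =
      (autOnPoints g)^[j] (Projectivization.mk L v hv)) :
    ∃ r : ℕ, (∀ (f : GL (Fin 2) L) (z : L), v = act f ![z, 1] → w = act f ![1, 0] →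
        (autOnPoints g)^[j] (f • affinePoint z) ≠ f • infinity → orderOf (lamRatio φ g m j f z) = r) ∧
      0 ≤ ordAt (Projectivization.mk L v hv) (PsiStar φ g p N) ∧
      (1 ≤ ordAt (Projectivization.mk L v hv) (PsiStar φ g p N) ↔
        ∃ n, N = m * n ∧ ¬ p ∣ n ∧ (n = 1 ∨ n = r ∨ ∃ s, 1 ≤ s ∧ n = r * q ^ s)) := by
  have hm0 : 0 < m := hm.1.1
  have : CharP L q := charP_of_injective_algebraMap (algebraMap K L).injective q
  obtain ⟨E, hE0, hE⟩ := exists_germ haut hv hvw ((onPoints_iterate_eq_iff m j hv).mp hmj)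
  refine ⟨orderOf (PowerSeries.coeff 1 (E PowerSeries.X)), ?_, ?_⟩
  · rintro f z rfl rfl hinf
    rw [lamRatio_eq hE0 hinf]
    simpa using hE 1
  have hne : ∀ n, 1 ≤ n → (E ^ n) PowerSeries.X ≠ PowerSeries.X := fun n hn =>
    pow_algHom_X_ne hd hv hvw (Nat.mul_pos hm0 hn) (hE n)
  have hcomm := haut.commute_onPoints
  have hper := autOnPoints_iterate_order hord (Projectivization.mk L v hv)
  have hiff := fun {k : ℕ} (hk : 0 < k) => exists_iterate_eq_iff hcomm hp hper hQ hm hk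
  rw [ordAt_PsiStar hd]
  by_cases hNm : ∃ n, N = m * n ∧ ¬ p ∣ n
  · obtain ⟨n, rfl, hpn⟩ := hNm
    have hn : 1 ≤ n := Nat.pos_of_mul_pos_left hN
    have hsum : ∑ k ∈ (m * n).divisors with ¬ p * k ∣ m * n, moebius (m * n / k) *
          ordAt (Projectivization.mk L v hv) (algebraMap (BinPoly K) (RatFun K) (Psi φ g p k)) =
        ∑ t ∈ n.divisors, moebius (n / t) * (contact E t : ℤ) := by
      -- Only the h-periods k = mt with t ∣ n contribute, and for these pk ∤ N holds automatically
      -- because p ∤ n.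
      symm
      refine Finset.sum_of_injOn (fun t => m * t)
        (fun t _ t' _ h => Nat.eq_of_mul_eq_mul_left hm0 h) ?_ ?_ ?_
      · intro t ht
        have ht' := Nat.mem_divisors.mp (Finset.mem_coe.mp ht)
        simp only [Finset.coe_filter, Set.mem_ofPred_eq, Nat.mem_divisors]
        refine ⟨⟨mul_dvd_mul_left m ht'.1, by omega⟩, fun h => hpn ?_⟩
        rw [mul_left_comm] at h
        exact (dvd_mul_right p t).trans (Nat.dvd_of_mul_dvd_mul_left hm0 h)
      · intro k hk hk'
        have hk1 := Nat.mem_divisors.mp (Finset.mem_of_mem_filter _ hk)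
        have hkpos : 0 < k := Nat.pos_of_dvd_of_pos hk1.1 hN
        rw [ordAt_Psi_eq_zero hd hkpos, mul_zero]
        intro hper'
        obtain ⟨t, rfl, -⟩ := (hiff hkpos).mp hper'
        exact hk' ⟨t, Finset.mem_coe.mpr (Nat.mem_divisors.mpr
          ⟨Nat.dvd_of_mul_dvd_mul_left hm0 hk1.1, by omega⟩), rfl⟩
      · intro t ht
        have ht' := (Nat.mem_divisors.mp ht).1
        have ht0 : 0 < t := Nat.pos_of_dvd_of_pos ht' hn
        rw [Nat.mul_div_mul_left _ _ hm0, ordAt_Psi_eq_contact hd hp hord hv hvw hQ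
          (Nat.mul_pos hm0 ht0) (fun h => (hp.dvd_mul.mp h).elim hj fun h => hpn (h.trans ht'))
          (hE t) (iterate_mul_eq hcomm hmj t)]
    rw [hsum]
    obtain ⟨h1, h2⟩ := moebius_sum_contact q hE0 hne hn
    refine ⟨h1, h2.trans ⟨fun h => ⟨n, rfl, hpn, h⟩, ?_⟩⟩
    rintro ⟨n', hn', -, h⟩
    rwa [Nat.eq_of_mul_eq_mul_left hm0 hn']
  · rw [Finset.sum_eq_zero]
    · refine ⟨le_rfl, fun h => absurd h (by norm_num), ?_⟩
      rintro ⟨n, h1, h2, -⟩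
      exact absurd ⟨n, h1, h2⟩ hNm
    · intro k hk
      obtain ⟨hk1, hk2⟩ := Finset.mem_filter.mp hk
      obtain ⟨l, rfl⟩ := (Nat.mem_divisors.mp hk1).1
      have hkpos : 0 < k := Nat.pos_of_mem_divisors hk1
      rw [ordAt_Psi_eq_zero hd hkpos, mul_zero]
      -- An h-period k = mt with p ∤ t and N = kl would have p ∣ tl, hence p ∣ l and pk ∣ N, against
      -- the condition on k.
      intro hper'
      obtain ⟨t, rfl, ht⟩ := (hiff hkpos).mp hper'
      refine hNm ⟨t * l, mul_assoc _ _ _, fun h => ?_⟩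
      refine (hp.dvd_mul.mp h).elim ht fun ⟨c, hc⟩ => hk2 ⟨c, ?_⟩
      rw [hc]; ring

theorem ordAt_PsiStar_eq_zero (hd : 2 ≤ d) (N : ℕ) {Q : P1 L}
    (h : ∀ k, 0 < k → ¬ HasHPeriod φ g p Q k) : ordAt Q (PsiStar φ g p N) = 0 := by
  rw [ordAt_PsiStar hd]
  refine Finset.sum_eq_zero fun k hk => ?_
  have hk0 := Nat.pos_of_mem_divisors (Finset.mem_of_mem_filter _ hk)
  rw [ordAt_Psi_eq_zero hd hk0 (h k hk0), mul_zero]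

end Assembly

end HTuned

namespace HTuned

open MvPolynomial

/-! ### Removing the zeros and poles at the fixed points. -/

section FixedPoints

variable {K : Type*} [Field K] {d : ℕ} {φ : RatMap K d} {g : GL (Fin 2) K} {p : ℕ}

local notation "L" => AlgebraicClosure K

theorem linForm_isHomogeneous (P : P1 K) : (linForm P).IsHomogeneous 1 :=
  lineForm_isHomogeneous P.rep

theorem linForm_ne_zero (P : P1 K) : linForm P ≠ 0 := (prime_lineForm P.rep_nonzero).ne_zero

theorem extend_linForm (P : P1 K) :
    extend (linForm P) = lineForm fun i => algebraMap K L (P.rep i) := by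
  simp [extend, linForm, lineForm]

theorem ratPoint_injective : Function.Injective (ratPoint (K := K)) := by
  intro P P' h
  rw [ratPoint, ratPoint, mk_eq_mk_iff_wedge] at h
  have h1 : wedge P.rep P'.rep = 0 := by
    apply (algebraMap K L).injective
    simpa [wedge] using h
  have h2 := (mk_eq_mk_iff_wedge P.rep_nonzero P'.rep_nonzero).mpr h1
  rwa [Projectivization.mk_rep, Projectivization.mk_rep] at h2

open Classical in
theorem ordAt_linForm (P : P1 K) (Q : P1 L) :
    ordAt Q (algebraMap (BinPoly K) (RatFun K) (linForm P)) = if Q = ratPoint P then 1 else 0 := by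
  rw [ordAt_algebraMap Q (linForm_ne_zero P), extend_linForm]
  have hv : (fun i => algebraMap K L (P.rep i)) ≠ 0 := by
    intro h
    exact P.rep_nonzero (funext fun i => (map_eq_zero _).mp (congrFun h i))
  split_ifs with h
  · obtain ⟨a, ha, hlin⟩ := exists_linForm_mk_eq hv
    rw [h, ratPoint, hlin, multiplicity_lineForm_smul ha, multiplicity_self, Nat.cast_one]
  · rw [Nat.cast_eq_zero]
    refine multiplicity_lineForm_eq_zero Q.rep_nonzero (lineForm_isHomogeneous _) fun h0 => h ?_
    rw [← Q.mk_rep, ratPoint, mk_eq_mk_iff_wedge]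
    rw [aeval_lineForm] at h0
    simp only [Algebra.algebraMap_self, RingHom.id_apply] at h0
    simp only [wedge]
    linear_combination h0

theorem IsFormQuotient.finite_ordAt_ne_zero {f : RatFun K} (hf : IsFormQuotient f) :
    {Q : P1 L | ordAt Q f ≠ 0}.Finite := by
  obtain ⟨A, B, m, n, hA, hB, hA0, hB0, rfl⟩ := hf
  refine ((finite_zeros_form (hA.map (algebraMap K L)) (extend_ne_zero hA0)).union
    (finite_zeros_form (hB.map (algebraMap K L)) (extend_ne_zero hB0))).subset ?_
  intro Q hQ
  by_contra hne
  simp only [Set.mem_union, Set.mem_ofPred_eq, not_or] at hne hQ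
  apply hQ
  have h1 := multiplicity_lineForm_eq_zero Q.rep_nonzero (hA.map (algebraMap K L)) hne.1
  have h2 := multiplicity_lineForm_eq_zero Q.rep_nonzero (hB.map (algebraMap K L)) hne.2
  rw [ordAt_div Q hA0 hB0]
  change (multiplicity (lineForm Q.rep) _ : ℤ) - (multiplicity (lineForm Q.rep) _ : ℤ) = 0
  rw [h1, h2]
  simp

/-- Dividing by powers of the linear forms at a set of rational points removes the zeros and poles at
these points and does not affect the order at any other point. -/
theorem IsFormQuotient.div_finprod {f : RatFun K} (hf : IsFormQuotient f) (s : Set (P1 K)) :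
    IsFormQuotient (f / ∏ᶠ P ∈ s,
        (algebraMap (BinPoly K) (RatFun K) (linForm P)) ^ ordAt (ratPoint P) f) ∧
      (∀ P ∈ s, ordAt (ratPoint P) (f / ∏ᶠ P ∈ s,
        (algebraMap (BinPoly K) (RatFun K) (linForm P)) ^ ordAt (ratPoint P) f) = 0) ∧
      ∀ Q, (∀ P ∈ s, Q ≠ ratPoint P) → ordAt Q (f / ∏ᶠ P ∈ s,
        (algebraMap (BinPoly K) (RatFun K) (linForm P)) ^ ordAt (ratPoint P) f) = ordAt Q f := by
  classical
  set F : P1 K → RatFun K := fun P =>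
    (algebraMap (BinPoly K) (RatFun K) (linForm P)) ^ ordAt (ratPoint P) f with hF
  have hform : ∀ P : P1 K, IsFormQuotient (algebraMap (BinPoly K) (RatFun K) (linForm P)) :=
    fun P => IsFormQuotient.of_form (linForm_isHomogeneous P) (linForm_ne_zero P)
  have hfin : {P : P1 K | ordAt (ratPoint P) f ≠ 0}.Finite :=
    hf.finite_ordAt_ne_zero.preimage ratPoint_injective.injOn
  -- Finite support is what makes the `finprod` a genuine product and not the default value 1.
  have hfin' : (s ∩ Function.mulSupport F).Finite := by
    refine hfin.subset fun P hP => ?_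
    intro h
    exact hP.2 (by simp only [hF]; rw [h, zpow_zero])
  have hprod : ∏ᶠ P ∈ s, F P = ∏ P ∈ hfin'.toFinset, F P := finprod_mem_eq_prod F hfin'
  have hFq : IsFormQuotient (∏ P ∈ hfin'.toFinset, F P) :=
    IsFormQuotient.prod _ _ fun P _ => (hform P).zpow _
  change IsFormQuotient (f / ∏ᶠ P ∈ s, F P) ∧ (∀ P ∈ s, ordAt (ratPoint P) (f / ∏ᶠ P ∈ s, F P) = 0) ∧
    ∀ Q, (∀ P ∈ s, Q ≠ ratPoint P) → ordAt Q (f / ∏ᶠ P ∈ s, F P) = ordAt Q f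
  rw [hprod]
  have hord : ∀ Q, ordAt Q (f / ∏ P ∈ hfin'.toFinset, F P) =
      ordAt Q f - ∑ P ∈ hfin'.toFinset, ordAt (ratPoint P) f * if Q = ratPoint P then 1 else 0 := by
    intro Q
    rw [ordAt_div_of_ne_zero Q hf.ne_zero hFq.ne_zero,
      ordAt_prod Q _ _ fun P _ => ((hform P).zpow _).ne_zero]
    congr 1
    refine Finset.sum_congr rfl fun P _ => ?_
    rw [ordAt_zpow Q (hform P).ne_zero, ordAt_linForm]
  refine ⟨div_eq_mul_inv f _ ▸ hf.mul hFq.inv, ?_, ?_⟩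
  · intro P hP
    rw [hord]
    simp only [ratPoint_injective.eq_iff, mul_ite, mul_one, mul_zero, Finset.sum_ite_eq,
      Set.Finite.mem_toFinset, Set.mem_inter_iff, hP, true_and, Function.mem_mulSupport]
    -- A point of `s` outside the support has factor 1; comparing orders there shows that its
    -- exponent was already 0.
    split_ifs with h
    · exact sub_self _
    · rw [sub_zero]
      have h1 := congrArg (ordAt (ratPoint P)) (not_not.mp h)
      have h2 := ordAt_zpow (ratPoint P) (one_ne_zero (α := RatFun K)) 0
      rw [zpow_zero, zero_mul] at h2
      rw [hF, ordAt_zpow _ (hform P).ne_zero, ordAt_linForm, if_pos rfl, mul_one, h2] at h1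
      exact h1
  · intro Q hQ
    rw [hord, Finset.sum_eq_zero, sub_zero]
    intro P hP
    have hP' := (Set.Finite.mem_toFinset hfin').mp hP
    rw [if_neg (hQ P hP'.1), mul_zero]

end FixedPoints

/-! ### Orders of the tuned polynomial and the criterion for positivity. -/

section Main

variable {K : Type*} [Field K] {d : ℕ} {φ : RatMap K d} {g : GL (Fin 2) K} {p : ℕ}

local notation "L" => AlgebraicClosure K

theorem isFormQuotient_PsiTilde (hd : 2 ≤ d) (N : ℕ) : IsFormQuotient (PsiTilde φ g p N) :=
  ((isFormQuotient_PsiStar hd N).div_finprod {P | ratPoint P ∈ fixSet g}).1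

theorem ordAt_PsiTilde_of_mem_fixSet (hd : 2 ≤ d) {N : ℕ}
    (hfix : ∀ Q ∈ fixSet g, ∃ P : P1 K, ratPoint P = Q) {Q : P1 L} (hQ : Q ∈ fixSet g) :
    ordAt Q (PsiTilde φ g p N) = 0 := by
  obtain ⟨P, rfl⟩ := hfix Q hQ
  exact ((isFormQuotient_PsiStar hd N).div_finprod {P | ratPoint P ∈ fixSet g}).2.1 P hQ

theorem ordAt_PsiTilde_of_notMem_fixSet (hd : 2 ≤ d) {N : ℕ} {Q : P1 L} (hQ : Q ∉ fixSet g) :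
    ordAt Q (PsiTilde φ g p N) = ordAt Q (PsiStar φ g p N) :=
  ((isFormQuotient_PsiStar hd N).div_finprod {P | ratPoint P ∈ fixSet g}).2.2 Q
    fun _ hP h => hQ (h ▸ hP)

theorem IsPrimitiveHPeriod.exists_index (hp : p.Prime)
    (hord : orderOf (Matrix.ProjGenLinGroup.mk g) = p) {Q : P1 L} {m : ℕ}
    (hm : IsPrimitiveHPeriod φ g p Q m) :
    ∃ j, 1 ≤ j ∧ j ≤ p - 1 ∧ φ.onPoints^[m] Q = (autOnPoints g)^[j] Q := by
  obtain ⟨j, _, hpj, hj⟩ := hm.1.2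
  refine ⟨j % p, Nat.pos_of_ne_zero (mt Nat.dvd_of_mod_eq_zero hpj),
    Nat.le_sub_one_of_lt (Nat.mod_lt _ hp.pos), hj.trans ?_⟩
  have hper : Function.IsPeriodicPt (autOnPoints g) p Q := autOnPoints_iterate_order hord Q
  exact (hper.iterate_mod_apply j).symm

theorem exists_isPrimitiveHPeriod {Q : P1 L} {k : ℕ} (hk : 0 < k) (h : HasHPeriod φ g p Q k) :
    ∃ m, IsPrimitiveHPeriod φ g p Q m := by
  classical
  have hex : ∃ N, 0 < N ∧ HasHPeriod φ g p Q N := ⟨k, hk, h⟩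
  exact ⟨Nat.find hex, Nat.find_spec hex, fun _ hN => Nat.find_min' hex hN⟩

theorem exists_wedge_ne_zero {F : Type*} [Field F] {v : Fin 2 → F} (hv : v ≠ 0) :
    ∃ w : Fin 2 → F, wedge v w ≠ 0 := by
  obtain ⟨w, hw⟩ := exists_dual_vector hv
  refine ⟨![-w 1, w 0], ?_⟩
  have : wedge v ![-w 1, w 0] = 1 := by
    simp only [wedge, Matrix.cons_val_zero, Matrix.cons_val_one]
    linear_combination hw
  rw [this]
  exact one_ne_zero

theorem ordAt_PsiTilde_nonneg (q : ℕ) [CharP K q] (hd : 2 ≤ d) (hp : p.Prime)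
    (hord : orderOf (Matrix.ProjGenLinGroup.mk g) = p) (haut : IsAut φ g)
    (hfix : ∀ Q ∈ fixSet g, ∃ P : P1 K, ratPoint P = Q) {N : ℕ} (hN : 1 ≤ N) (Q : P1 L) :
    0 ≤ ordAt Q (PsiTilde φ g p N) := by
  by_cases hQ : Q ∈ fixSet g
  · rw [ordAt_PsiTilde_of_mem_fixSet hd hfix hQ]
  rw [ordAt_PsiTilde_of_notMem_fixSet hd hQ]
  by_cases h : ∃ k, 0 < k ∧ HasHPeriod φ g p Q k
  · obtain ⟨k, hk, hkQ⟩ := h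
    obtain ⟨m, hm⟩ := exists_isPrimitiveHPeriod hk hkQ
    obtain ⟨j, -, hpj, hj⟩ := hm.1.2
    induction Q using Projectivization.ind with
    | h v hv =>
      -- Nonnegativity does not involve λ₁, so any direction transverse to v serves and no finite
      -- chart is needed.
      obtain ⟨w, hw⟩ := exists_wedge_ne_zero hv
      obtain ⟨r, -, h0, -⟩ := ordAt_PsiStar_nonneg_and_pos_iff q hd hp hord haut hN hv hw hQ hm hpj hj
      exact h0
  · push Not at h
    rw [ordAt_PsiStar_eq_zero hd N h]

/-- The condition p ∤ n, with n one of 1, r, r q^s, becomes the side conditions: for s ≥ 1, p ∤ r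
q^s means p ∤ r and q ≠ p. An infinite r appears as `orderOf` equal to 0, which p divides, so only N
= m remains. -/
theorem one_le_ordAt_PsiTilde_iff (q : ℕ) [CharP K q] (hd : 2 ≤ d) (hp : p.Prime)
    (hord : orderOf (Matrix.ProjGenLinGroup.mk g) = p) (haut : IsAut φ g) {N : ℕ} (hN : 1 ≤ N)
    {Q : P1 L} (hQ : Q ∉ fixSet g) {f : GL (Fin 2) L} {z : L} (hf : IsFiniteChart g Q f z) :
    1 ≤ ordAt Q (PsiTilde φ g p N) ↔
      ∃ m j : ℕ, IsPrimitiveHPeriod φ g p Q m ∧ 1 ≤ j ∧ j ≤ p - 1 ∧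
        φ.onPoints^[m] Q = (autOnPoints g)^[j] Q ∧
        (N = m ∨
          (N = m * orderOf (lamRatio φ g m j f z) ∧ ¬ p ∣ orderOf (lamRatio φ g m j f z)) ∨
          ∃ s : ℕ, 1 ≤ s ∧ N = m * orderOf (lamRatio φ g m j f z) * q ^ s ∧
            ¬ p ∣ orderOf (lamRatio φ g m j f z) ∧ q ≠ p) := by
  obtain ⟨rfl, hinf⟩ := hf
  have hv0 : (![z, 1] : Fin 2 → L) ≠ 0 := fun h => one_ne_zero (congrFun h 1)
  have hvw : wedge (act f ![z, 1]) (act f ![1, 0]) ≠ 0 := by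
    rw [wedge_act]
    refine mul_ne_zero ?_ (by simp [wedge])
    simpa using ((Matrix.isUnit_iff_isUnit_det _).mp f.isUnit).ne_zero
  have hpoint : f • affinePoint z = Projectivization.mk L (act f ![z, 1]) (act_ne_zero f hv0) :=
    smul_mk_eq f hv0
  have key : ∀ {m j : ℕ}, IsPrimitiveHPeriod φ g p (f • affinePoint z) m → 1 ≤ j → j ≤ p - 1 →
      φ.onPoints^[m] (f • affinePoint z) = (autOnPoints g)^[j] (f • affinePoint z) →
      (1 ≤ ordAt (f • affinePoint z) (PsiStar φ g p N) ↔ ∃ n, N = m * n ∧ ¬ p ∣ n ∧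
        (n = 1 ∨ n = orderOf (lamRatio φ g m j f z) ∨
          ∃ s, 1 ≤ s ∧ n = orderOf (lamRatio φ g m j f z) * q ^ s)) := by
    intro m j hm hj1 hj2 hmj
    have hpj : ¬ p ∣ j := Nat.not_dvd_of_pos_of_lt hj1 (by have := hp.pos; omega)
    have hinfj := hinf j
    rw [hpoint] at hQ hm hmj ⊢
    obtain ⟨r, hr, -, h⟩ := ordAt_PsiStar_nonneg_and_pos_iff q hd hp hord haut hN
      (act_ne_zero f hv0) hvw hQ hm hpj hmj
    rw [hr f z rfl rfl hinfj]
    exact h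
  rw [ordAt_PsiTilde_of_notMem_fixSet hd hQ]
  constructor
  · intro h
    have hex : ∃ k, 0 < k ∧ HasHPeriod φ g p (f • affinePoint z) k := by
      by_contra! hne
      rw [ordAt_PsiStar_eq_zero hd N hne] at h
      omega
    obtain ⟨k, hk, hkQ⟩ := hex
    obtain ⟨m, hm⟩ := exists_isPrimitiveHPeriod hk hkQ
    obtain ⟨j, hj1, hj2, hmj⟩ := hm.exists_index hp hord
    refine ⟨m, j, hm, hj1, hj2, hmj, ?_⟩
    obtain ⟨n, rfl, hpn, hn⟩ := (key hm hj1 hj2 hmj).mp h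
    rcases hn with rfl | rfl | ⟨s, hs, rfl⟩
    · exact Or.inl (mul_one m)
    · exact Or.inr (Or.inl ⟨rfl, hpn⟩)
    · refine Or.inr (Or.inr ⟨s, hs, (mul_assoc _ _ _).symm, fun h => hpn (h.mul_right _), ?_⟩)
      rintro rfl
      exact hpn ((dvd_pow_self q (by omega)).mul_left _)
  · rintro ⟨m, j, hm, hj1, hj2, hmj, hcases⟩
    rw [key hm hj1 hj2 hmj]
    rcases hcases with rfl | ⟨rfl, hr⟩ | ⟨s, hs, rfl, hr, hqp⟩
    · exact ⟨1, (mul_one _).symm, hp.one_lt.ne' ∘ Nat.dvd_one.mp, Or.inl rfl⟩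
    · exact ⟨_, rfl, hr, Or.inr (Or.inl rfl)⟩
    · refine ⟨_, mul_assoc _ _ _, fun h => ?_, Or.inr (Or.inr ⟨s, hs, rfl⟩)⟩
      -- Characteristic 0 is impossible here: s ≥ 1 would make N = 0.
      have hq : q.Prime := by
        refine (CharP.char_is_prime_or_zero K q).resolve_right ?_
        rintro rfl
        rw [zero_pow (by omega), mul_zero] at hN
        omega
      refine (hp.dvd_mul.mp h).elim hr fun h => hqp ?_
      exact ((Nat.prime_dvd_prime_iff_eq hp hq).mp (hp.dvd_of_dvd_pow h)).symm

end Main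

end HTuned

theorem mainTheorem5 {K : Type*} [Field K] (q : ℕ) [CharP K q]
    (d : ℕ) (hd : 2 ≤ d) (φ : HTuned.RatMap K d)
    (p : ℕ) (hp : p.Prime) (g : GL (Fin 2) K)
    (hord : orderOf (Matrix.ProjGenLinGroup.mk g) = p)
    (haut : HTuned.IsAut φ g)
    (hfix : ∀ Q ∈ HTuned.fixSet g, ∃ P : HTuned.P1 K, HTuned.ratPoint P = Q)
    (N : ℕ) (hN : 1 ≤ N) :
    (∃ A : HTuned.BinPoly K,
      HTuned.PsiTilde φ g p N = algebraMap (HTuned.BinPoly K) (HTuned.RatFun K) A) ∧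
    (∀ Q : HTuned.P1 (AlgebraicClosure K), 0 ≤ HTuned.ordAt Q (HTuned.PsiTilde φ g p N)) ∧
    (∀ Q ∈ HTuned.fixSet g, HTuned.ordAt Q (HTuned.PsiTilde φ g p N) = 0) ∧
    (∀ Q : HTuned.P1 (AlgebraicClosure K), Q ∉ HTuned.fixSet g →
      ∀ (f : GL (Fin 2) (AlgebraicClosure K)) (z : AlgebraicClosure K),
        HTuned.IsFiniteChart g Q f z →
      (1 ≤ HTuned.ordAt Q (HTuned.PsiTilde φ g p N) ↔
        ∃ m j : ℕ, HTuned.IsPrimitiveHPeriod φ g p Q m ∧ 1 ≤ j ∧ j ≤ p - 1 ∧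
          φ.onPoints^[m] Q = (HTuned.autOnPoints g)^[j] Q ∧
          (N = m ∨
            (N = m * orderOf (HTuned.lamRatio φ g m j f z) ∧
              ¬ p ∣ orderOf (HTuned.lamRatio φ g m j f z)) ∨
            ∃ s : ℕ, 1 ≤ s ∧ N = m * orderOf (HTuned.lamRatio φ g m j f z) * q ^ s ∧
              ¬ p ∣ orderOf (HTuned.lamRatio φ g m j f z) ∧ q ≠ p))) := by
  have hnonneg := HTuned.ordAt_PsiTilde_nonneg q hd hp hord haut hfix hN
  exact ⟨(HTuned.isFormQuotient_PsiTilde hd N).exists_eq_algebraMap hnonneg, hnonneg,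
    fun Q hQ => HTuned.ordAt_PsiTilde_of_mem_fixSet hd hfix hQ,
    fun Q hQ f z hf => HTuned.one_le_ordAt_PsiTilde_iff q hd hp hord haut hN hQ hf⟩
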